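/- Let $L$ be the two-sorted language with a sort of points (variables $t$) and a sort of sets (variables $s$), a binary relation $E(t,s)$ and 4-ary relations $C(t_1,t_2,t_3,s)$ and $D(s_1,s_2,s_3,t)$. Let $K$ be the class of all finite $L$-structures such that (1) for every $s$, $C(-,-,-,s)$ is a (strict, directed) circular order on $\{t : E(t,s)\}$, and $C(t_1,t_2,t_3,s)$ implies $E(t_i,s)$ for $i=1,2,3$; (2) for every $t$, $D(-,-,-,t)$ is a circular order on $\{s : \neg E(t,s)\}$, and $D(s_1,s_2,s_3,t)$ implies $\neg E(t,s_i)$ for $i=1,2,3$. Then $K$ is a Fraïssé class and has a Fraïssé limit. The complete theory $T$ of the Fraïssé limit is $\omega$-categorical, eliminates quantifiers and has the tree property of the second kind ($\mathrm{TP}_2$): there are a formula $\varphi(x,y)$, a number $k<\omega$ and an array $(a^j_i)_{i,j<\omega}$ in a model of $T$ such that for each $j$ any $k+1$ of the formulas $\varphi(x,a^j_i)$, $i<\omega$, are jointly inconsistent, while for every $f:\omega\to\omega$ the set $\{\varphi(x,a^j_{f(j)}) : j<\omega\}$ is consistent (realized in that model). Let $\mathfrak C$ be a $\kappa$-saturated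 model of $T$ and $M\prec\mathfrak C$ with $|M|<\kappa$ (such pairs exist). A formula $\varphi(x,a)$ divides over $M$ if for some $k$ there are $a_i\equiv_M a$ ($i<\omega$) such that any $k+1$ of the formulas $\varphi(x,a_i)$ are jointly inconsistent; it quasi divides over $M$ if there are finitely many $a_i\equiv_M a$ such that $\{\varphi(x,a_i)\}_i$ is inconsistent; it forks over $M$ if it implies a finite disjunction of formulas each of which divides over $M$. A type forks over $M$ if it contains a formula that forks over $M$. Then: (a) there is a set $s_0\in\mathfrak C$ with $\neg E(t,s_0)$ for all points $t\in M$, and there is a point $t_0\in\mathfrak C$ with $E(t_0,s)$ for all sets $s\in M$; (b) for every such $s_0$, the formula $E(x,s_0)$ forks over $M$ but neither divides nor quasi divides over $M$; (c) for every such $t_0$, the formula $\neg E(t_0,y)$ ($y$ of the sort of sets) forks over $M$ but neither divides nor quasi divides over $M$; (d) for every such $t_0$, the type $\mathrm{tp}(t_0/M)$ has no strictly non-forking global extension: there is no complete type $q$ over $\mathfrak C$ extending $\mathrm{tp}(t_0/M)$ such that $q$ does not fork over $M$ and, for every $B$ with $M\subseteq B\subseteq\mathfrak C$, $|B|<\kappa$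 and every $c\models q|_B$, $\mathrm{tp}(B/Mc)$ does not fork over $M$. -/

import Mathlib

open FirstOrder Cardinal

universe u v w

namespace Ziegler

/-! ### Types, dividing and forking inside an ambient model

`N` is the ambient ("monster") model. All parameters and tuples are taken in `N`, and consequence
between formulas with parameters is evaluated in `N`. Saturation of `N` is a separate hypothesis,
`IsSaturated`. A formula `φ(x, a)` with parameters is given by an `L`-formula `φ(x, y)` and a
finite tuple `a`. -/

section General

variable {L : FirstOrder.Language.{u, v}} {N : Type w} [L.Structure N]

/-- The space `S_m(A)` of complete types in `m` variables over the parameter set `A ⊆ N`. -/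
abbrev TypeOver (L : FirstOrder.Language.{u, v}) {N : Type w} [L.Structure N] (A : Set N) (m : ℕ) :=
  (L[[A]].completeTheory N).CompleteType (Fin m)

/-- The complete type `tp(c / A)`. -/
def tp (L : FirstOrder.Language.{u, v}) {N : Type w} [L.Structure N] [Nonempty N] (A : Set N) {m : ℕ}
    (c : Fin m → N) : TypeOver L A m :=
  (L[[A]].completeTheory N).typeOf c

/-- The formula `φ(x, a)`, in the language with constants for the elements of `A`. -/
def inst {A : Set N} {m n : ℕ} (φ : L.Formula (Fin m ⊕ Fin n)) (a : Fin n → A) :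
    L[[A]].Formula (Fin m) :=
  FirstOrder.Language.BoundedFormula.constantsVarsEquiv.symm
    (FirstOrder.Language.Formula.relabel (Sum.elim Sum.inr (fun i => Sum.inl (a i))) φ)

/-- `φ(x, a) ∈ p`. -/
def HasFormula {A : Set N} {m n : ℕ} (p : TypeOver L A m) (φ : L.Formula (Fin m ⊕ Fin n))
    (a : Fin n → A) : Prop :=
  FirstOrder.Language.Formula.equivSentence (inst φ a) ∈ p

theorem hasFormula_tp [Nonempty N] {A : Set N} {m n : ℕ} (c : Fin m → N)
    (φ : L.Formula (Fin m ⊕ Fin n)) (a : Fin n → A) :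
    HasFormula (tp L A c) φ a ↔ φ.Realize (Sum.elim c (fun i => (a i : N))) := by
  refine FirstOrder.Language.Theory.CompleteType.formula_mem_typeOf.trans ?_
  unfold inst FirstOrder.Language.Formula.Realize
  rw [← FirstOrder.Language.BoundedFormula.realize_constantsVarsEquiv, Equiv.apply_symm_apply]
  refine FirstOrder.Language.Formula.realize_relabel.trans ?_
  refine iff_of_eq (congrArg _ ?_)
  funext i
  rcases i with i | i <;> rfl

/-- `N` is `κ`-saturated: every complete `1`-type over fewer than `κ` parameters is realized. -/
def IsSaturated (L : FirstOrder.Language.{u, v}) (N : Type w) [L.Structure N] [Nonempty N]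
    (κ : Cardinal.{w}) : Prop :=
  ∀ A : Set N, #A < κ → ∀ p : TypeOver L A 1, ∃ c : Fin 1 → N, tp L A c = p

/-- `φ(x, a)` divides over `A`: for some `k` there are `b_i ≡_A a`, `i < ω`, such that any `k + 1`
of the formulas `φ(x, b_i)` are jointly inconsistent. -/
def Divides [Nonempty N] (A : Set N) {m n : ℕ} (φ : L.Formula (Fin m ⊕ Fin n))
    (a : Fin n → N) : Prop :=
  ∃ (k : ℕ) (b : ℕ → Fin n → N), (∀ i, tp L A (b i) = tp L A a) ∧
    ∀ I : Finset ℕ, I.card = k + 1 →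
      ¬ ∃ x : Fin m → N, ∀ i ∈ I, φ.Realize (Sum.elim x (b i))

/-- `φ(x, a)` quasi divides over `A`: there are finitely many `b_i ≡_A a` such that the formulas
`φ(x, b_i)` are jointly inconsistent. -/
def QuasiDivides [Nonempty N] (A : Set N) {m n : ℕ} (φ : L.Formula (Fin m ⊕ Fin n))
    (a : Fin n → N) : Prop :=
  ∃ (r : ℕ) (b : Fin r → Fin n → N), (∀ i, tp L A (b i) = tp L A a) ∧
    ¬ ∃ x : Fin m → N, ∀ i, φ.Realize (Sum.elim x (b i))

/-- `φ(x, a)` forks over `A`: it implies a finite disjunction of formulas `ψ_i(x, b_i)`, each of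
which divides over `A`. -/
def Forks [Nonempty N] (A : Set N) {m n : ℕ} (φ : L.Formula (Fin m ⊕ Fin n))
    (a : Fin n → N) : Prop :=
  ∃ (r : ℕ) (l : Fin r → ℕ) (ψ : ∀ i, L.Formula (Fin m ⊕ Fin (l i))) (b : ∀ i, Fin (l i) → N),
    (∀ x : Fin m → N, φ.Realize (Sum.elim x a) → ∃ i, (ψ i).Realize (Sum.elim x (b i))) ∧
    ∀ i, Divides A (ψ i) (b i)

/-- `C` is non-forking independent from `B` over `A`, i.e. `tp(C / A ∪ B)` does not fork over `A`:
no formula over `A ∪ B` that holds of a finite tuple from `C` forks over `A`. -/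
def IndepF (L : FirstOrder.Language.{u, v}) {N : Type w} [L.Structure N] [Nonempty N]
    (C A B : Set N) : Prop :=
  ∀ (m n : ℕ) (φ : L.Formula (Fin m ⊕ Fin n)) (c : Fin m → N) (b : Fin n → N),
    (∀ i, c i ∈ C) → (∀ i, b i ∈ A ∪ B) → φ.Realize (Sum.elim c b) → ¬ Forks A φ b

/-- Global types: complete types over the whole ambient model. -/
abbrev GlobalType (L : FirstOrder.Language.{u, v}) (N : Type w) [L.Structure N] (m : ℕ) :=
  TypeOver L (Set.univ : Set N) m

/-- `φ(x, a) ∈ q` for a global type `q`. -/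
def GlobalType.Has {m n : ℕ} (q : GlobalType L N m) (φ : L.Formula (Fin m ⊕ Fin n))
    (a : Fin n → N) : Prop :=
  HasFormula q φ (fun i => ⟨a i, Set.mem_univ _⟩)

/-- The global type `q` extends `p ∈ S_m(A)`. -/
def GlobalType.Extends {m : ℕ} (q : GlobalType L N m) {A : Set N} (p : TypeOver L A m) : Prop :=
  ∀ (n : ℕ) (φ : L.Formula (Fin m ⊕ Fin n)) (a : Fin n → A),
    HasFormula p φ a → GlobalType.Has q φ (fun i => (a i : N))

/-- `q` does not fork over `A`: no formula in `q` forks over `A`. -/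
def GlobalType.NonForking [Nonempty N] {m : ℕ} (q : GlobalType L N m) (A : Set N) : Prop :=
  ∀ (n : ℕ) (φ : L.Formula (Fin m ⊕ Fin n)) (a : Fin n → N),
    GlobalType.Has q φ a → ¬ Forks A φ a

/-- `c ⊨ q|_C`. -/
def GlobalType.RealizesRestriction {m : ℕ} (q : GlobalType L N m) (C : Set N)
    (c : Fin m → N) : Prop :=
  ∀ (n : ℕ) (φ : L.Formula (Fin m ⊕ Fin n)) (a : Fin n → N), (∀ i, a i ∈ C) →
    GlobalType.Has q φ a → φ.Realize (Sum.elim c a)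

/-- `q` is strictly non-forking over `A`: it does not fork over `A`, and whenever `C ⊇ A` is small
(of size `< κ`) and `c ⊨ q|_C`, then `tp(C / A c)` does not fork over `A`. -/
def GlobalType.StrictlyNonForking [Nonempty N] (κ : Cardinal.{w}) {m : ℕ}
    (q : GlobalType L N m) (A : Set N) : Prop :=
  GlobalType.NonForking q A ∧
    ∀ C : Set N, A ⊆ C → #C < κ → ∀ c : Fin m → N, GlobalType.RealizesRestriction q C c →
      IndepF L C A (Set.range c)

end General

/-- `T` has the tree property of the second kind, witnessed by an array `a j i` (`j` is the row)
in a model of `T`: every row is `k`-inconsistent and every vertical path is consistent. -/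
def HasTP2 {L : FirstOrder.Language.{u, v}} (T : L.Theory) : Prop :=
  ∃ (N : FirstOrder.Language.Theory.ModelType.{u, v, w} T) (m n : ℕ) (φ : L.Formula (Fin m ⊕ Fin n)) (k : ℕ)
    (a : ℕ → ℕ → Fin n → N),
    (∀ (j : ℕ) (I : Finset ℕ), I.card = k + 1 →
      ¬ ∃ x : Fin m → N, ∀ i ∈ I, φ.Realize (Sum.elim x (a j i))) ∧
    (∀ f : ℕ → ℕ, ∃ x : Fin m → N, ∀ j, φ.Realize (Sum.elim x (a j (f j))))

/-- `T` eliminates quantifiers. -/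
def HasQE {L : FirstOrder.Language.{u, v}} (T : L.Theory) : Prop :=
  ∀ (n : ℕ) (φ : L.Formula (Fin n)), ∃ ψ : L.Formula (Fin n),
    FirstOrder.Language.BoundedFormula.IsQF ψ ∧ φ ⇔[T] ψ

/-! ### The language and the class of finite structures -/

/-- The relation symbols. The sort "points" is a unary predicate, the sort "sets" is its
complement. -/
inductive Rel : ℕ → Type
  | point : Rel 1
  | mem : Rel 2
  | C : Rel 4
  | D : Rel 4

/-- The language with the relations `E(t, s)`, `C(t₁, t₂, t₃, s)`, `D(s₁, s₂, s₃, t)` on two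
sorts. -/
def Lang : FirstOrder.Language.{0, 0} := ⟨fun _ => Empty, Rel⟩

def pointSym : Lang.Relations 1 := Rel.point

def memSym : Lang.Relations 2 := Rel.mem

def cSym : Lang.Relations 4 := Rel.C

def dSym : Lang.Relations 4 := Rel.D

instance lang_functions_isEmpty (n : ℕ) : IsEmpty (Lang.Functions n) := inferInstanceAs (IsEmpty Empty)

section Structures

variable {X : Type u} [Lang.Structure X]

def IsPoint (t : X) : Prop := FirstOrder.Language.Structure.RelMap pointSym ![t]

def IsSet (s : X) : Prop := ¬ IsPoint s

/-- `E(t, s)`. -/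
def E (t s : X) : Prop := FirstOrder.Language.Structure.RelMap memSym ![t, s]

def C (t₁ t₂ t₃ s : X) : Prop :=
  FirstOrder.Language.Structure.RelMap cSym ![t₁, t₂, t₃, s]

def D (s₁ s₂ s₃ t : X) : Prop :=
  FirstOrder.Language.Structure.RelMap dSym ![s₁, s₂, s₃, t]

end Structures

/-- On the set `A`, the ternary relation `R` is the (strict, directed) betweenness relation of a
circular order. -/
def IsCircularOrderOn {X : Type u} (R : X → X → X → Prop) (A : Set X) : Prop :=
  ∃ _ : CircularOrder A, ∀ a b c : A, R a b c ↔ sbtw a b c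

/-- The axioms of the class: sorts of the arguments, and the two circular order axioms with their
domains. -/
structure IsZiegler (X : Type u) [Lang.Structure X] : Prop where
  E_sorts : ∀ t s : X, E t s → IsPoint t ∧ IsSet s
  C_domain : ∀ t₁ t₂ t₃ s : X, C t₁ t₂ t₃ s → E t₁ s ∧ E t₂ s ∧ E t₃ s
  C_circular : ∀ s : X, IsSet s → IsCircularOrderOn (fun t₁ t₂ t₃ => C t₁ t₂ t₃ s) {t | E t s}
  D_domain : ∀ s₁ s₂ s₃ t : X, D s₁ s₂ s₃ t →
    IsPoint t ∧ (IsSet s₁ ∧ ¬ E t s₁) ∧ (IsSet s₂ ∧ ¬ E t s₂) ∧ (IsSet s₃ ∧ ¬ E t s₃)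
  D_circular : ∀ t : X, IsPoint t →
    IsCircularOrderOn (fun s₁ s₂ s₃ => D s₁ s₂ s₃ t) {s | IsSet s ∧ ¬ E t s}

/-- The class `K` of all finite structures satisfying the axioms. -/
def finiteClass : Set (CategoryTheory.Bundled.{u} Lang.Structure) :=
  {X | Finite X ∧ IsZiegler X}

/-- The formula `E(x, y)`, with object variable `x` (a point) and parameter variable `y`. -/
def memFormula : Lang.Formula (Fin 1 ⊕ Fin 1) :=
  FirstOrder.Language.Relations.formula₂ memSym
    (FirstOrder.Language.Term.var (Sum.inl 0)) (FirstOrder.Language.Term.var (Sum.inr 0))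

/-- The formula `¬ E(y, x)`, with object variable `x` of the sort of sets and parameter
variable `y`. -/
def notMemFormula : Lang.Formula (Fin 1 ⊕ Fin 1) :=
  (FirstOrder.Language.Relations.formula₁ pointSym (FirstOrder.Language.Term.var (Sum.inl 0))).not ⊓
  (FirstOrder.Language.Relations.formula₂ memSym
    (FirstOrder.Language.Term.var (Sum.inr 0)) (FirstOrder.Language.Term.var (Sum.inl 0))).not

theorem realize_memFormula {X : Type u} [Lang.Structure X] (x a : Fin 1 → X) :
    memFormula.Realize (Sum.elim x a) ↔ E (x 0) (a 0) := by
  rw [memFormula, FirstOrder.Language.Formula.realize_rel₂]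
  exact Iff.rfl

theorem realize_notMemFormula {X : Type u} [Lang.Structure X] (x a : Fin 1 → X) :
    notMemFormula.Realize (Sum.elim x a) ↔ IsSet (x 0) ∧ ¬ E (a 0) (x 0) := by
  rw [notMemFormula, FirstOrder.Language.Formula.realize_inf, FirstOrder.Language.Formula.realize_not,
    FirstOrder.Language.Formula.realize_not, FirstOrder.Language.Formula.realize_rel₂, FirstOrder.Language.Formula.realize_rel₁]
  exact Iff.rfl

end Ziegler

/-! The axioms treat every circle separately. A new point may therefore choose freely which sets it
joins, where it enters each of their circles, and how the sets it avoids are ordered (`IsZ.ptExt`).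
Exchanging points with sets, and `E` with its negation, preserves the axioms (`IsZ.dual`), so
constructions for points also serve for sets. Putting a new point into all sets outside the common
part amalgamates one-point extensions (`IsZ.exists_amalgam`), and a generic filter of finite
approximations yields a countable structure with the one-point extension property `HasExt`. By back
and forth, this property characterizes the limit among countable structures satisfying the axioms.
It is first-order, so it holds in all models: this gives categoricity. Ultrahomogeneity makes the
truth of a formula depend only on the quantifier-free pattern of the tuple: this gives quantifier
elimination. In a saturated model the extension property holds over all small parameter sets
(`hasExt_of_isSaturated`).

Forking: let `s₀` be a set without points in `M`, and let `u`, `v` be two points of its circle, so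
that `E(x, s₀)` is the union of the arcs `[u, v)` and `[v, u)`. Take `u`, `v` to be clones over `M`
of one point `p`. The circle of `s₀` contains nothing of `M`, and two points of a circle have no
order among themselves, so the type of the pair over `M s₀` does not record how the two lie relative
to `p` around `s₀`. Hence there are conjugate pairs whose arcs `[u, v)` are pairwise disjoint, and
other conjugate pairs whose arcs `[v, u)` are pairwise disjoint (`exists_clonePairs`). Both arcs
divide and `E(x, s₀)` forks. It does not quasi divide, because finitely many sets always have a
common point. The dual structure gives the same for `¬ E(t₀, y)`. If `c` realizes a non-forking
extension of `tp(t₀ / M)` over `M s₀`, then `¬ E(c, s₀)`, and this formula forks over `M` when read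
as a condition on `s₀`; so the extension is not strictly non-forking. For TP2 one sequence of
disjoint arcs is used in the circles of infinitely many sets at once. -/

namespace Ziegler

/-! ### Circular orders and their cuts -/

/-- `T` is the strict betweenness relation of a circular order on `{x | P x}`. -/
structure IsCirc {X : Type*} (P : X → Prop) (T : X → X → X → Prop) : Prop where
  dom : ∀ a b c, T a b c → P a ∧ P b ∧ P c
  cyc : ∀ a b c, T a b c → T b c a
  asymm : ∀ a b c, T a b c → ¬ T c b a
  trans : ∀ a b c d, T a b c → T b d c → T a d c
  total : ∀ a b c, P a → P b → P c → a ≠ b → b ≠ c → a ≠ c → T a b c ∨ T c b a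

/-- `L` is a strict linear order on `{x | P x}` obtained by cutting the circular order `T`. -/
structure IsCut {X : Type*} (P : X → Prop) (T : X → X → X → Prop) (L : X → X → Prop) : Prop where
  dom : ∀ a b, L a b → P a ∧ P b
  irrefl : ∀ a, ¬ L a a
  trans : ∀ a b c, L a b → L b c → L a c
  total : ∀ a b, P a → P b → a ≠ b → L a b ∨ L b a
  cut : ∀ a b c, L a b → L b c → T a b c

section Circ

variable {X Y : Type*} {P : X → Prop} {T : X → X → X → Prop} {L : X → X → Prop}

theorem IsCirc.ne (h : IsCirc P T) {a b c : X} (ht : T a b c) : a ≠ b ∧ b ≠ c ∧ a ≠ c := by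
  have h2 : ∀ a b, ¬ T a b a := fun a b h' => h.asymm _ _ _ h' h'
  refine ⟨?_, ?_, ?_⟩
  · rintro rfl; exact h2 _ _ (h.cyc _ _ _ ht)
  · rintro rfl; exact h2 _ _ (h.cyc _ _ _ (h.cyc _ _ _ ht))
  · rintro rfl; exact h2 _ _ ht

theorem IsCirc.comap (h : IsCirc P T) {f : Y → X} (hf : Function.Injective f) :
    IsCirc (fun y => P (f y)) (fun a b c => T (f a) (f b) (f c)) where
  dom _ _ _ h' := h.dom _ _ _ h'
  cyc _ _ _ h' := h.cyc _ _ _ h'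
  asymm _ _ _ h' := h.asymm _ _ _ h'
  trans _ _ _ _ h' := h.trans _ _ _ _ h'
  total _ _ _ ha hb hc hab hbc hac := h.total _ _ _ ha hb hc (hf.ne hab) (hf.ne hbc) (hf.ne hac)

theorem IsCut.comap (h : IsCut P T L) {f : Y → X} (hf : Function.Injective f) :
    IsCut (fun y => P (f y)) (fun a b c => T (f a) (f b) (f c)) (fun a b => L (f a) (f b)) where
  dom _ _ h' := h.dom _ _ h'
  irrefl _ h' := h.irrefl _ h'
  trans _ _ _ h' := h.trans _ _ _ h'
  total _ _ ha hb hab := h.total _ _ ha hb (hf.ne hab)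
  cut _ _ _ h' := h.cut _ _ _ h'

theorem isCirc_congr {P' : X → Prop} {T' : X → X → X → Prop} (hP : ∀ x, P x ↔ P' x)
    (hT : ∀ a b c, T a b c ↔ T' a b c) : IsCirc P T ↔ IsCirc P' T' := by
  have h1 : P = P' := funext fun x => propext (hP x)
  have h2 : T = T' := funext fun a => funext fun b => funext fun c => propext (hT a b c)
  rw [h1, h2]

/-- The cut of a circular order immediately before `g`. -/
def cutBefore (P : X → Prop) (T : X → X → X → Prop) (g : X) (a b : X) : Prop :=
  (a = g ∧ b ≠ g ∧ P a ∧ P b) ∨ T g a b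

/-- The cut of a circular order immediately after `g`. -/
def cutAfter (P : X → Prop) (T : X → X → X → Prop) (g : X) (a b : X) : Prop :=
  (b = g ∧ a ≠ g ∧ P a ∧ P b) ∨ T g a b

theorem IsCirc.isCut_cutBefore (h : IsCirc P T) {g : X} (hg : P g) :
    IsCut P T (cutBefore P T g) := by
  have hd := h.dom
  have hc := h.cyc
  have ha := h.asymm
  have ht := h.trans
  have hn := fun a b c => h.ne (a := a) (b := b) (c := c)
  have htot := h.total
  constructor <;> simp only [cutBefore] <;> grind

theorem IsCirc.isCut_cutAfter (h : IsCirc P T) {g : X} (hg : P g) :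
    IsCut P T (cutAfter P T g) := by
  have hd := h.dom
  have hc := h.cyc
  have ha := h.asymm
  have ht := h.trans
  have hn := fun a b c => h.ne (a := a) (b := b) (c := c)
  have htot := h.total
  constructor <;> simp only [cutAfter] <;> grind

/-- The position of a point in a circle, seen as a cut of the remaining points. In the amalgamation
this reads off where a prescribed new point sits. -/
theorem IsCirc.isCut_at (h : IsCirc P T) {g : X} (hg : P g) :
    IsCut (fun x => P x ∧ x ≠ g) T (T g) := by
  have hd := h.dom
  have hc := h.cyc
  have ha := h.asymm
  have ht := h.trans
  have hn := fun a b c => h.ne (a := a) (b := b) (c := c)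
  have htot := h.total
  constructor <;> grind

theorem IsCirc.exists_isCut (h : IsCirc P T) : ∃ L, IsCut P T L := by
  by_cases hP : ∃ g, P g
  · obtain ⟨g, hg⟩ := hP
    exact ⟨_, h.isCut_cutBefore hg⟩
  · exact ⟨fun _ _ => False, by simp, by simp, by simp, fun a _ ha => (hP ⟨a, ha⟩).elim, by simp⟩

/-- Insertion of a new point `none` at the cut `L` of a circular order. -/
def insertCirc (T : X → X → X → Prop) (L : X → X → Prop) : Option X → Option X → Option X → Prop
  | some a, some b, some c => T a b c
  | none, some b, some c => L b c
  | some a, none, some c => L c a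
  | some a, some b, none => L a b
  | _, _, _ => False

theorem IsCirc.insert (h : IsCirc P T) (hL : IsCut P T L) :
    IsCirc (fun x : Option X => x.elim True P) (insertCirc T L) := by
  have hd := h.dom
  have hc := h.cyc
  have ha := h.asymm
  have ht := h.trans
  have htot := h.total
  have hn := fun a b c => h.ne (a := a) (b := b) (c := c)
  have ld := hL.dom
  have li := hL.irrefl
  have lt := hL.trans
  have ltot := hL.total
  have lc := hL.cut
  constructor
  · rintro (_ | a) (_ | b) (_ | c) <;> simp only [insertCirc, Option.elim] <;> grind
  · rintro (_ | a) (_ | b) (_ | c) <;> simp only [insertCirc] <;> grind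
  · rintro (_ | a) (_ | b) (_ | c) <;> simp only [insertCirc] <;> grind
  · rintro (_ | a) (_ | b) (_ | c) (_ | d) <;> simp only [insertCirc] <;> grind
  · rintro (_ | a) (_ | b) (_ | c) <;> simp only [insertCirc, Option.elim, ne_eq, Option.some.injEq] <;> grind

/-- The companion of `IsCirc.insert` for circles that the new element does not join. -/
theorem IsCirc.option (h : IsCirc P T) :
    IsCirc (fun x : Option X => x.elim False P) (insertCirc T (fun _ _ => False)) := by
  have hd := h.dom
  have hc := h.cyc
  have ha := h.asymm
  have ht := h.trans
  have htot := h.total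
  constructor
  · rintro (_ | a) (_ | b) (_ | c) <;> simp only [insertCirc, Option.elim] <;> grind
  · rintro (_ | a) (_ | b) (_ | c) <;> simp only [insertCirc] <;> grind
  · rintro (_ | a) (_ | b) (_ | c) <;> simp only [insertCirc] <;> grind
  · rintro (_ | a) (_ | b) (_ | c) (_ | d) <;> simp only [insertCirc] <;> grind
  · rintro (_ | a) (_ | b) (_ | c) <;> simp only [insertCirc, Option.elim, ne_eq, Option.some.injEq] <;> grind

theorem isCirc_empty : IsCirc (fun _ : X => False) (fun _ _ _ => False) := by
  constructor <;> simp

/-- A cut of a finite part of a circular order extends to a cut of the whole. -/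
theorem IsCirc.exists_isCut_extending (h : IsCirc P T) [Finite Y] {f : Y → X}
    (hf : Function.Injective f) {L₀ : Y → Y → Prop}
    (h₀ : IsCut (fun y => P (f y)) (fun a b c => T (f a) (f b) (f c)) L₀) :
    ∃ L, IsCut P T L ∧ ∀ a b, L₀ a b → L (f a) (f b) := by
  by_cases hP : ∃ y, P (f y)
  · obtain ⟨y, hy⟩ := hP
    have : IsTrans Y L₀ := ⟨h₀.trans⟩
    have : Std.Irrefl L₀ := ⟨h₀.irrefl⟩
    -- Cutting the whole circle just before the least element `m` of the finite part works: if `m`,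
    -- `a`, `b` are increasing for `L₀`, then `T m a b`.
    obtain ⟨m, hm, hmin⟩ := (Finite.wellFounded_of_trans_of_irrefl L₀).has_min {y | P (f y)} ⟨y, hy⟩
    refine ⟨_, h.isCut_cutBefore hm, fun a b hab => ?_⟩
    obtain ⟨ha, hb⟩ := h₀.dom _ _ hab
    by_cases ham : a = m
    · subst ham
      refine Or.inl ⟨rfl, fun hba => ?_, ha, hb⟩
      have := hf hba
      subst this
      exact h₀.irrefl _ hab
    · refine Or.inr (h₀.cut _ _ _ ?_ hab)
      exact (h₀.total _ _ hm ha (Ne.symm ham)).resolve_right (hmin a ha)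
  · obtain ⟨L, hL⟩ := h.exists_isCut
    exact ⟨L, hL, fun a b hab => (hP ⟨a, (h₀.dom _ _ hab).1⟩).elim⟩

end Circ

/-! ### Bare relations: duality, one-point extensions, amalgamation -/

/-- The relations of an `L`-structure on `X`, as a bare tuple of predicates. -/
@[ext] structure Rels (X : Type u) where
  pt : X → Prop
  E : X → X → Prop
  C : X → X → X → X → Prop
  D : X → X → X → X → Prop

namespace Rels

variable {X Y Z : Type*}

/-- Pullback of the relations along a map. -/
def comap (r : Rels X) (f : Y → X) : Rels Y where
  pt a := r.pt (f a)
  E a b := r.E (f a) (f b)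
  C a b c d := r.C (f a) (f b) (f c) (f d)
  D a b c d := r.D (f a) (f b) (f c) (f d)

/-- The duality exchanging points and sets. -/
def dual (r : Rels X) : Rels X where
  pt a := ¬ r.pt a
  E a b := ¬ r.pt a ∧ r.pt b ∧ ¬ r.E b a
  C := r.D
  D := r.C

/-- The universal axioms of the class. -/
structure IsZ (r : Rels X) : Prop where
  sorts : ∀ t s, r.E t s → r.pt t ∧ ¬ r.pt s
  C_dom : ∀ a b c s, r.C a b c s → ¬ r.pt s
  D_dom : ∀ a b c t, r.D a b c t → r.pt t
  C_circ : ∀ s, ¬ r.pt s → IsCirc (fun t => r.E t s) (fun a b c => r.C a b c s)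
  D_circ : ∀ t, r.pt t → IsCirc (fun s => ¬ r.pt s ∧ ¬ r.E t s) (fun a b c => r.D a b c t)

theorem comap_comap (r : Rels X) (f : Y → X) (g : Z → Y) :
    (r.comap f).comap g = r.comap (fun z => f (g z)) := rfl

theorem dual_comap (r : Rels X) (f : Y → X) : (r.comap f).dual = r.dual.comap f := rfl

theorem IsZ.comap {r : Rels X} (h : r.IsZ) {f : Y → X} (hf : Function.Injective f) :
    (r.comap f).IsZ where
  sorts _ _ h' := h.sorts _ _ h'
  C_dom _ _ _ _ h' := h.C_dom _ _ _ _ h'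
  D_dom _ _ _ _ h' := h.D_dom _ _ _ _ h'
  C_circ _ h' := (h.C_circ _ h').comap hf
  D_circ _ h' := (h.D_circ _ h').comap hf

theorem IsZ.dual_dual {r : Rels X} (h : r.IsZ) : r.dual.dual = r := by
  have := h.sorts
  ext <;> simp only [dual] <;> grind

theorem IsZ.dual {r : Rels X} (h : r.IsZ) : r.dual.IsZ where
  sorts _ _ h' := ⟨h'.1, not_not.2 h'.2.1⟩
  C_dom _ _ _ _ h' := not_not.2 (h.D_dom _ _ _ _ h')
  D_dom _ _ _ _ h' := h.C_dom _ _ _ _ h'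
  C_circ s hs := by
    have hs' : r.pt s := not_not.1 hs
    exact (isCirc_congr (fun x => by simp [Rels.dual, hs']) (fun _ _ _ => Iff.rfl)).1
      (h.D_circ s hs')
  D_circ t ht := by
    refine (isCirc_congr (fun x => ?_) (fun _ _ _ => Iff.rfl)).1 (h.C_circ t ht)
    have := h.sorts x t
    have ht' : ¬ r.pt t := ht
    simp only [Rels.dual]
    tauto

/-- Adjunction of a new point `none` with prescribed memberships `e`, prescribed positions `L` in
the circles of the sets, and a prescribed circular order `R`. -/
def ptExt (r : Rels X) (e : X → Prop) (L : X → X → X → Prop) (R : X → X → X → Prop) :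
    Rels (Option X) where
  pt x := x.elim True r.pt
  E a b := b.elim False fun s => a.elim (e s) fun t => r.E t s
  C a b c d := d.elim False fun s => insertCirc (fun t₁ t₂ t₃ => r.C t₁ t₂ t₃ s)
    (fun x y => e s ∧ L s x y) a b c
  D a b c d := d.elim (insertCirc R (fun _ _ => False) a b c) fun t =>
    insertCirc (fun s₁ s₂ s₃ => r.D s₁ s₂ s₃ t) (fun _ _ => False) a b c

theorem ptExt_comap_some (r : Rels X) (e : X → Prop) (L : X → X → X → Prop) (R : X → X → X → Prop) :
    (r.ptExt e L R).comap some = r := rfl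

/-- No axiom links two different circles, so the three choices are independent. The new point enters
only the `C`-circles of the sets in `e`; not being a set, it enters no `D`-circle, and its own
`D`-circle is `R`. -/
theorem IsZ.ptExt {r : Rels X} (h : r.IsZ) {e : X → Prop} {L : X → X → X → Prop}
    {R : X → X → X → Prop} (he : ∀ s, e s → ¬ r.pt s)
    (hL : ∀ s, e s → IsCut (fun t => r.E t s) (fun a b c => r.C a b c s) (L s))
    (hR : IsCirc (fun s => ¬ r.pt s ∧ ¬ e s) R) : (r.ptExt e L R).IsZ where
  sorts := by
    rintro (_ | t) (_ | s) h'
    · exact h'.elim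
    · exact ⟨trivial, he s h'⟩
    · exact h'.elim
    · exact h.sorts t s h'
  C_dom := by
    rintro a b c (_ | s) h'
    · exact h'.elim
    · by_cases hs : e s
      · exact he s hs
      · rcases a with _ | a <;> rcases b with _ | b <;> rcases c with _ | c <;>
          first
          | exact h.C_dom _ _ _ _ h'
          | exact (hs h'.1).elim
          | exact h'.elim
  D_dom := by
    rintro a b c (_ | t) h'
    · trivial
    · rcases a with _ | a <;> rcases b with _ | b <;> rcases c with _ | c <;>
        first
        | exact h.D_dom _ _ _ _ h'
        | exact h'.elim
  C_circ := by
    rintro (_ | s) hs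
    · exact (hs trivial).elim
    · by_cases hes : e s
      · refine (isCirc_congr ?_ ?_).1 ((h.C_circ s hs).insert (hL s hes))
        · rintro (_ | x)
          · exact ⟨fun _ => hes, fun _ => trivial⟩
          · exact Iff.rfl
        · rintro (_ | a) (_ | b) (_ | c) <;>
            simp [Rels.ptExt, insertCirc, hes]
      · refine (isCirc_congr ?_ ?_).1 (h.C_circ s hs).option
        · rintro (_ | x)
          · exact ⟨fun h => h.elim, fun h => (hes h).elim⟩
          · exact Iff.rfl
        · rintro (_ | a) (_ | b) (_ | c) <;>
            simp [Rels.ptExt, insertCirc, hes]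
  D_circ := by
    rintro (_ | t) ht
    · refine (isCirc_congr ?_ ?_).1 hR.option
      · rintro (_ | x) <;> simp [Rels.ptExt]
      · intro a b c
        exact Iff.rfl
    · refine (isCirc_congr ?_ ?_).1 (h.D_circ t ht).option
      · rintro (_ | x) <;> simp [Rels.ptExt]
      · intro a b c
        exact Iff.rfl

theorem IsZ.C_dom' {r : Rels X} (h : r.IsZ) {a b c s : X} (hC : r.C a b c s) :
    ¬ r.pt s ∧ r.E a s ∧ r.E b s ∧ r.E c s :=
  ⟨h.C_dom _ _ _ _ hC, (h.C_circ s (h.C_dom _ _ _ _ hC)).dom _ _ _ hC⟩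

theorem IsZ.D_dom' {r : Rels X} (h : r.IsZ) {a b c t : X} (hD : r.D a b c t) :
    r.pt t ∧ (¬ r.pt a ∧ ¬ r.E t a) ∧ (¬ r.pt b ∧ ¬ r.E t b) ∧ (¬ r.pt c ∧ ¬ r.E t c) :=
  ⟨h.D_dom _ _ _ _ hD, (h.D_circ t (h.D_dom _ _ _ _ hD)).dom _ _ _ hD⟩

/-- Every one-point extension of relations by a point is of the form `ptExt`. -/
theorem IsZ.ext_of_pt {r r' : Rels (Option X)} (h : r.IsZ) (h' : r'.IsZ)
    (hpt : r.pt none) (hpt' : r'.pt none) (hs : r.comap some = r'.comap some)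
    (hE : ∀ s, r.E none (some s) → r'.E none (some s))
    (hE' : ∀ s, r'.E none (some s) → r.E none (some s))
    (hC : ∀ a b s, r.C none (some a) (some b) (some s) → r'.C none (some a) (some b) (some s))
    (hD : ∀ a b c, r.D (some a) (some b) (some c) none → r'.D (some a) (some b) (some c) none) :
    r = r' := by
  have hs1 : ∀ a, r.pt (some a) ↔ r'.pt (some a) := fun a =>
    iff_of_eq (congrFun (congrArg Rels.pt hs) a)
  have hs2 : ∀ a b, r.E (some a) (some b) ↔ r'.E (some a) (some b) := fun a b =>
    iff_of_eq (congrFun (congrFun (congrArg Rels.E hs) a) b)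
  have hs3 : ∀ a b c d, r.C (some a) (some b) (some c) (some d) ↔
      r'.C (some a) (some b) (some c) (some d) := fun a b c d =>
    iff_of_eq (congrFun (congrFun (congrFun (congrFun (congrArg Rels.C hs) a) b) c) d)
  have hs4 : ∀ a b c d, r.D (some a) (some b) (some c) (some d) ↔
      r'.D (some a) (some b) (some c) (some d) := fun a b c d =>
    iff_of_eq (congrFun (congrFun (congrFun (congrFun (congrArg Rels.D hs) a) b) c) d)
  have hpe : ∀ x, r.pt x ↔ r'.pt x := by
    rintro (_ | x)
    · simp [hpt, hpt']
    · exact hs1 x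
  have hEe : ∀ x y, r.E x y ↔ r'.E x y := by
    rintro x (_ | y)
    · exact ⟨fun h1 => ((h.sorts _ _ h1).2 hpt).elim, fun h1 => ((h'.sorts _ _ h1).2 hpt').elim⟩
    · rcases x with _ | x
      · exact ⟨hE y, hE' y⟩
      · exact hs2 x y
  -- A circular order is determined by one implication.
  have key : ∀ {P : Option X → Prop} {T T' : Option X → Option X → Option X → Prop},
      IsCirc P T → IsCirc P T' → (∀ a b c, T a b c → T' a b c) → ∀ a b c, T a b c ↔ T' a b c := by
    intro P T T' h1 h2 himp a b c
    refine ⟨himp a b c, fun h3 => ?_⟩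
    obtain ⟨ha, hb, hc⟩ := h2.dom _ _ _ h3
    obtain ⟨n1, n2, n3⟩ := h2.ne h3
    exact (h1.total a b c ha hb hc n1 n2 n3).resolve_right fun h4 =>
      h2.asymm _ _ _ h3 (himp _ _ _ h4)
  have hCe : ∀ a b c s, r.C a b c s ↔ r'.C a b c s := by
    intro a b c s
    by_cases hp : r.pt s
    · exact ⟨fun h1 => ((h.C_dom _ _ _ _ h1) hp).elim,
        fun h1 => ((h'.C_dom _ _ _ _ h1) ((hpe s).1 hp)).elim⟩
    · have h1 := h.C_circ s hp
      have h2 := h'.C_circ s (fun h3 => hp ((hpe s).2 h3))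
      rw [isCirc_congr (fun x => (hEe x s).symm) (fun _ _ _ => Iff.rfl)] at h2
      refine key h1 h2 ?_ a b c
      rcases s with _ | s
      · exact (hp hpt).elim
      -- A strict triple contains `none` at most once; if it does, it is rotated until `none` stands
      -- first, the form covered by `hC`.
      · rintro (_ | a) (_ | b) (_ | c) h3
        · exact ((h1.ne h3).1 rfl).elim
        · exact ((h1.ne h3).1 rfl).elim
        · exact ((h1.ne h3).2.2 rfl).elim
        · exact hC _ _ _ h3
        · exact ((h1.ne h3).2.1 rfl).elim
        · exact h2.cyc _ _ _ (h2.cyc _ _ _ (hC _ _ _ (h1.cyc _ _ _ h3)))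
        · exact h2.cyc _ _ _ (hC _ _ _ (h1.cyc _ _ _ (h1.cyc _ _ _ h3)))
        · exact (hs3 _ _ _ _).1 h3
  have hDe : ∀ a b c s, r.D a b c s ↔ r'.D a b c s := by
    intro a b c t
    by_cases hp : r.pt t
    · have h1 := h.D_circ t hp
      have h2 := h'.D_circ t ((hpe t).1 hp)
      rw [isCirc_congr (fun x => by rw [← hEe, ← hpe]) (fun _ _ _ => Iff.rfl)] at h2
      refine key h1 h2 ?_ a b c
      intro a b c h3
      obtain ⟨ha, hb, hc⟩ := h1.dom _ _ _ h3
      rcases a with _ | a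
      · exact (ha.1 hpt).elim
      rcases b with _ | b
      · exact (hb.1 hpt).elim
      rcases c with _ | c
      · exact (hc.1 hpt).elim
      rcases t with _ | t
      · exact hD _ _ _ h3
      · exact (hs4 _ _ _ _).1 h3
    · exact ⟨fun h1 => (hp (h.D_dom _ _ _ _ h1)).elim,
        fun h1 => (hp ((hpe t).2 (h'.D_dom _ _ _ _ h1))).elim⟩
  exact Rels.ext (funext fun _ => propext (hpe _))
    (funext fun _ => funext fun _ => propext (hEe _ _))
    (funext fun _ => funext fun _ => funext fun _ => funext fun _ => propext (hCe _ _ _ _))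
    (funext fun _ => funext fun _ => funext fun _ => funext fun _ => propext (hDe _ _ _ _))

/-- The new point joins every set outside the image of `σ`. The sets it avoids then all come from
`A`, and their circular order is copied from `r₀`. In the circle of a set from `A`, the cut
prescribed on the finite part extends to all of `Y`; in the other circles any cut will do. -/
theorem IsZ.exists_amalgam_pt {A Y : Type*} [Finite A] {rY : Rels Y} (hY : rY.IsZ)
    {r₀ : Rels (Option A)} (h₀ : r₀.IsZ) (hpt : r₀.pt none) {σ : A → Y}
    (hσ : Function.Injective σ) (hr : rY.comap σ = r₀.comap some) :
    ∃ r₁ : Rels (Option Y), r₁.IsZ ∧ r₁.comap some = rY ∧ r₁.comap (Option.map σ) = r₀ := by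
  have e1 : ∀ a, rY.pt (σ a) ↔ r₀.pt (some a) := fun a =>
    iff_of_eq (congrFun (congrArg Rels.pt hr) a)
  have e2 : ∀ a b, rY.E (σ a) (σ b) ↔ r₀.E (some a) (some b) := fun a b =>
    iff_of_eq (congrFun (congrFun (congrArg Rels.E hr) a) b)
  have e3 : ∀ a b c d, rY.C (σ a) (σ b) (σ c) (σ d) ↔ r₀.C (some a) (some b) (some c) (some d) :=
    fun a b c d => iff_of_eq (congrFun (congrFun (congrFun (congrFun
      (congrArg Rels.C hr) a) b) c) d)
  let e : Y → Prop := fun s => ¬ rY.pt s ∧ ∀ a, σ a = s → r₀.E none (some a)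
  have hL : ∀ s, ∃ L, e s → IsCut (fun t => rY.E t s) (fun a b c => rY.C a b c s) L ∧
      ∀ a, σ a = s → ∀ b c, r₀.C none (some b) (some c) (some a) → L (σ b) (σ c) := by
    intro s
    by_cases hs : e s
    · have hc := hY.C_circ s hs.1
      by_cases ha : ∃ a, σ a = s
      · obtain ⟨a, rfl⟩ := ha
        have hc0 := h₀.C_circ (some a) (fun h => hs.1 ((e1 a).2 h))
        have hea := hs.2 a rfl
        obtain ⟨L, hL, hL'⟩ := hc.exists_isCut_extending hσ
          (L₀ := fun b c => r₀.C none (some b) (some c) (some a)) (by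
            have := (hc0.isCut_at hea).comap (Option.some_injective A)
            convert this using 1
            · funext b
              simp [e2]
            · funext b c d
              exact propext (e3 b c d a))
        refine ⟨L, fun _ => ⟨hL, fun a' ha' b c h => ?_⟩⟩
        rw [hσ ha'] at h
        exact hL' _ _ h
      · obtain ⟨L, hL⟩ := hc.exists_isCut
        exact ⟨L, fun _ => ⟨hL, fun a h => (ha ⟨a, h⟩).elim⟩⟩
    · exact ⟨fun _ _ => False, fun h => (hs h).elim⟩
  choose L hL using hL
  let R : Y → Y → Y → Prop := fun x y z => ∃ a b c, σ a = x ∧ σ b = y ∧ σ c = z ∧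
    r₀.D (some a) (some b) (some c) none
  have hd := h₀.D_circ none hpt
  have hdom : ∀ x, ¬ rY.pt x ∧ ¬ e x → ∃ a, σ a = x ∧ ¬ r₀.pt (some a) ∧ ¬ r₀.E none (some a) := by
    rintro x ⟨h1, h2⟩
    simp only [e, not_and, not_forall] at h2
    obtain ⟨a, rfl, h3⟩ := h2 h1
    exact ⟨a, rfl, fun h => h1 ((e1 a).2 h), h3⟩
  have hR : IsCirc (fun s => ¬ rY.pt s ∧ ¬ e s) R := by
    constructor
    · rintro _ _ _ ⟨a, b, c, rfl, rfl, rfl, h⟩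
      have aux : ∀ a, ¬ r₀.pt (some a) ∧ ¬ r₀.E none (some a) → ¬ rY.pt (σ a) ∧ ¬ e (σ a) :=
        fun a h => ⟨fun h' => h.1 ((e1 a).1 h'), fun h' => h.2 (h'.2 a rfl)⟩
      obtain ⟨ha, hb, hc⟩ := hd.dom _ _ _ h
      exact ⟨aux _ ha, aux _ hb, aux _ hc⟩
    · rintro _ _ _ ⟨a, b, c, rfl, rfl, rfl, h⟩
      exact ⟨b, c, a, rfl, rfl, rfl, hd.cyc _ _ _ h⟩
    · rintro _ _ _ ⟨a, b, c, rfl, rfl, rfl, h⟩ ⟨c', b', a', h1, h2, h3, h'⟩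
      rw [hσ h1, hσ h2, hσ h3] at h'
      exact hd.asymm _ _ _ h h'
    · rintro _ _ _ _ ⟨a, b, c, rfl, rfl, rfl, h⟩ ⟨b', d, c', h1, rfl, h3, h'⟩
      rw [hσ h1, hσ h3] at h'
      exact ⟨a, d, c, rfl, rfl, rfl, hd.trans _ _ _ _ h h'⟩
    · intro x y z hx hy hz hxy hyz hxz
      obtain ⟨a, rfl, ha⟩ := hdom x hx
      obtain ⟨b, rfl, hb⟩ := hdom y hy
      obtain ⟨c, rfl, hc⟩ := hdom z hz
      have nn : ∀ {a b : A}, σ a ≠ σ b → some a ≠ some b := fun h h' => h (congrArg σ (Option.some_injective _ h'))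
      rcases hd.total _ _ _ ha hb hc (nn hxy) (nn hyz) (nn hxz) with h | h
      · exact Or.inl ⟨a, b, c, rfl, rfl, rfl, h⟩
      · exact Or.inr ⟨c, b, a, rfl, rfl, rfl, h⟩
  have hZ := hY.ptExt (fun s hs => hs.1) (fun s hs => (hL s hs).1) hR
  refine ⟨_, hZ, rfl, ?_⟩
  refine (h₀.ext_of_pt (hZ.comap (Option.map_injective hσ)) hpt trivial hr.symm ?_ ?_ ?_ ?_).symm
  · intro a h
    refine ⟨fun h' => (h₀.sorts _ _ h).2 ((e1 a).1 h'), fun a' ha' => ?_⟩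
    rwa [hσ ha']
  · intro a h
    exact h.2 a rfl
  · intro a b s h
    have hs : e (σ s) := ⟨fun h' => (h₀.C_dom _ _ _ _ h) ((e1 s).1 h'), fun a' ha' => by
      rw [hσ ha']; exact ((h₀.C_dom' h).2.1)⟩
    exact ⟨hs, (hL _ hs).2 s rfl _ _ h⟩
  · intro a b c h
    exact ⟨a, b, c, rfl, rfl, rfl, h⟩

theorem IsZ.exists_amalgam {A Y : Type*} [Finite A] {rY : Rels Y} (hY : rY.IsZ)
    {r₀ : Rels (Option A)} (h₀ : r₀.IsZ) {σ : A → Y}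
    (hσ : Function.Injective σ) (hr : rY.comap σ = r₀.comap some) :
    ∃ r₁ : Rels (Option Y), r₁.IsZ ∧ r₁.comap some = rY ∧ r₁.comap (Option.map σ) = r₀ := by
  by_cases hpt : r₀.pt none
  · exact hY.exists_amalgam_pt h₀ hpt hσ hr
  · obtain ⟨r₁, h1, h2, h3⟩ := hY.dual.exists_amalgam_pt h₀.dual hpt hσ (congrArg Rels.dual hr)
    refine ⟨r₁.dual, h1.dual, ?_, ?_⟩
    · rw [← dual_comap, h2, hY.dual_dual]
    · rw [← dual_comap, h3, h₀.dual_dual]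

end Rels

/-! ### The one-point extension property -/

namespace Rels

/-- One-point extensions of fewer than `κ` elements are realized. -/
def HasExt {N : Type u} (r : Rels N) (κ : Cardinal.{u}) : Prop :=
  ∀ (A : Type u), #A < κ → ∀ r₀ : Rels (Option A), r₀.IsZ → ∀ σ : A → N, Function.Injective σ →
    r.comap σ = r₀.comap some → ∃ z, (∀ a, σ a ≠ z) ∧ r.comap (fun x => x.elim z σ) = r₀

theorem HasExt.dual {N : Type u} {r : Rels N} {κ : Cardinal.{u}} (h : r.HasExt κ) (hr : r.IsZ) :
    r.dual.HasExt κ := by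
  intro A hA r₀ h₀ σ hσ hc
  obtain ⟨z, hz, hz'⟩ := h A hA r₀.dual h₀.dual σ hσ (by
    rw [← dual_comap, ← hc, ← dual_comap, (hr.comap hσ).dual_dual])
  refine ⟨z, hz, ?_⟩
  rw [← dual_comap, hz', h₀.dual_dual]

/-- Realization of a one-point extension given by predicates on the ambient structure. -/
theorem HasExt.exists_pt {N : Type u} {r : Rels N} {κ : Cardinal.{u}} (h : r.HasExt κ)
    (hr : r.IsZ) (A : Set N) (hA : #A < κ) (e : N → Prop) (L : N → N → N → Prop)
    (R : N → N → N → Prop) (he : ∀ s, e s → ¬ r.pt s)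
    (hL : ∀ s, e s → IsCut (fun t => r.E t s) (fun a b c => r.C a b c s) (L s))
    (hR : IsCirc (fun s => ¬ r.pt s ∧ ¬ e s) R) :
    ∃ z, z ∉ A ∧ r.pt z ∧ (∀ s ∈ A, r.E z s ↔ e s) ∧
      (∀ s ∈ A, ∀ a ∈ A, ∀ b ∈ A, r.C z a b s ↔ e s ∧ L s a b) ∧
      (∀ a ∈ A, ∀ b ∈ A, ∀ c ∈ A, r.D a b c z ↔ R a b c) := by
  have hinj : Function.Injective (fun a : A => (a : N)) := Subtype.val_injective
  -- Since `e`, `L`, `R` satisfy their conditions on all of `N`, their restrictions to `A`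
  -- automatically form an admissible extension.
  have hZ := (hr.comap hinj).ptExt (e := fun s => e s) (L := fun s a b => L s a b)
    (R := fun a b c => R a b c) (fun s hs => he s hs) (fun s hs => (hL s hs).comap hinj)
    (hR.comap hinj)
  obtain ⟨z, hz, hz'⟩ := h A hA _ hZ _ hinj (ptExt_comap_some _ _ _ _).symm
  refine ⟨z, fun hzA => hz ⟨z, hzA⟩ rfl, ?_, ?_, ?_, ?_⟩
  · have := congrFun (congrArg Rels.pt hz') none
    exact this.symm ▸ trivial
  · intro s hs
    exact iff_of_eq (congrFun (congrFun (congrArg Rels.E hz') none) (some ⟨s, hs⟩))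
  · intro s hs a ha b hb
    exact iff_of_eq (congrFun (congrFun (congrFun (congrFun (congrArg Rels.C hz') none)
      (some ⟨a, ha⟩)) (some ⟨b, hb⟩)) (some ⟨s, hs⟩))
  · intro a ha b hb c hc
    exact iff_of_eq (congrFun (congrFun (congrFun (congrFun (congrArg Rels.D hz')
      (some ⟨a, ha⟩)) (some ⟨b, hb⟩)) (some ⟨c, hc⟩)) none)

/-- There is a point in all sets of a small set of parameters. -/
theorem HasExt.exists_pt_mem {N : Type u} {r : Rels N} {κ : Cardinal.{u}} (h : r.HasExt κ)
    (hr : r.IsZ) (A : Set N) (hA : #A < κ) :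
    ∃ z, z ∉ A ∧ r.pt z ∧ ∀ s ∈ A, ¬ r.pt s → r.E z s := by
  have hcut : ∀ s, ∃ L, ¬ r.pt s → IsCut (fun t => r.E t s) (fun a b c => r.C a b c s) L := by
    intro s
    by_cases hs : r.pt s
    · exact ⟨fun _ _ => False, fun h => (h hs).elim⟩
    · obtain ⟨L, hL⟩ := (hr.C_circ s hs).exists_isCut
      exact ⟨L, fun _ => hL⟩
  choose L hL using hcut
  -- A point lying in all sets has an empty `D`-circle, so there is no order to prescribe.
  obtain ⟨z, h1, h2, h3, -⟩ := h.exists_pt hr A hA (fun s => ¬ r.pt s) L (fun _ _ _ => False)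
    (fun _ h => h) hL ((isCirc_congr (fun x => by simp) (fun _ _ _ => Iff.rfl)).1 isCirc_empty)
  exact ⟨z, h1, h2, fun s hs hs' => (h3 s hs).2 hs'⟩

/-- Reduces finite extension problems to those over `Fin n`, of which a countable structure has only
countably many. -/
theorem hasExt_aleph0_of_fin {N : Type u} {r : Rels N}
    (h : ∀ (n : ℕ) (r₀ : Rels (Option (Fin n))), r₀.IsZ → ∀ σ : Fin n → N, Function.Injective σ →
      r.comap σ = r₀.comap some → ∃ z, (∀ a, σ a ≠ z) ∧ r.comap (fun x => x.elim z σ) = r₀) :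
    r.HasExt ℵ₀ := by
  intro A hA r₀ h₀ σ hσ hc
  have : Finite A := Cardinal.lt_aleph0_iff_finite.1 hA
  obtain ⟨n, ⟨f⟩⟩ := Finite.exists_equiv_fin A
  obtain ⟨z, hz, hz'⟩ := h n (r₀.comap (Option.map f.symm))
    (h₀.comap (Option.map_injective f.symm.injective)) (σ ∘ f.symm)
    (hσ.comp f.symm.injective) (congrArg (fun r => Rels.comap r f.symm) hc)
  refine ⟨z, fun a => by simpa using hz (f a), ?_⟩
  have h1 := congrArg (fun r => Rels.comap r (Option.map f)) hz'
  have h2 : (fun x : Option A => (Option.map f.symm (Option.map f x))) = id := by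
    funext x; cases x <;> simp
  have h3 : (fun x : Option A => (Option.map f x).elim z (σ ∘ f.symm)) = fun x => x.elim z σ := by
    funext x; cases x <;> simp
  simp only [comap_comap] at h1
  rw [h3] at h1
  rw [h1]
  exact congrArg (Rels.comap r₀) h2

instance finite_rels {X : Type*} [Finite X] : Finite (Rels X) := by
  let f : Rels X → (X → Prop) × (X → X → Prop) × (X → X → X → X → Prop) ×
    (X → X → X → X → Prop) := fun r => (r.pt, r.E, r.C, r.D)
  refine Finite.of_injective f fun r r' h => ?_
  simp only [f, Prod.mk.injEq] at h
  exact Rels.ext h.1 h.2.1 h.2.2.1 h.2.2.2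

end Rels

/-! ### Construction of the generic structure -/

/-- Finite approximations of the generic structure on `ℕ`. -/
structure Approx where
  S : Finset ℕ
  -- Only the restriction to `S` carries information; the values elsewhere are junk.
  r : Rels ℕ
  isZ : (r.comap (fun x : S => (x : ℕ))).IsZ

namespace Approx

instance : Preorder Approx where
  le p q := ∃ h : p.S ⊆ q.S, p.r.comap (fun x : p.S => (x : ℕ)) = q.r.comap (fun x : p.S => (x : ℕ))
  le_refl p := ⟨subset_rfl, rfl⟩
  le_trans p q s := by
    rintro ⟨h1, h2⟩ ⟨h3, h4⟩
    refine ⟨h1.trans h3, h2.trans ?_⟩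
    exact congrArg (fun r => Rels.comap r (fun x : p.S => (⟨x, h1 x.2⟩ : q.S))) h4

theorem comap_eq {p q : Approx} (h : p ≤ q) {A : Type*} (f : A → ℕ) (hf : ∀ a, f a ∈ p.S) :
    p.r.comap f = q.r.comap f :=
  congrArg (fun r => Rels.comap r (fun a => (⟨f a, hf a⟩ : p.S))) h.2

theorem exists_extend (p : Approx) {y : ℕ} (hy : y ∉ p.S) {r₁ : Rels (Option p.S)} (h₁ : r₁.IsZ)
    (hr : r₁.comap some = p.r.comap (fun x : p.S => (x : ℕ))) :
    ∃ q : Approx, p ≤ q ∧ y ∈ q.S ∧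
      q.r.comap (fun x : Option p.S => x.elim y (fun x => (x : ℕ))) = r₁ := by
  classical
  let f : ℕ → Option p.S := fun k => if h : k ∈ p.S then some ⟨k, h⟩ else none
  have hf : ∀ x : p.S, f x = some x := fun x => by simp [f]
  have hfy : f y = none := by simp [f, hy]
  refine ⟨⟨insert y p.S, r₁.comap f, ?_⟩, ⟨Finset.subset_insert _ _, ?_⟩,
    Finset.mem_insert_self _ _, ?_⟩
  · rw [Rels.comap_comap]
    refine h₁.comap ?_
    rintro ⟨a, ha⟩ ⟨b, hb⟩ hab
    simp only [f] at hab
    ext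
    rcases Finset.mem_insert.1 ha with h | h <;> rcases Finset.mem_insert.1 hb with h' | h'
    · exact h.trans h'.symm
    · simp [h, hy, h'] at hab
    · simp [h, hy, h'] at hab
    · simpa [h, h'] using hab
  · rw [Rels.comap_comap, ← hr]
    exact congrArg (Rels.comap r₁) (funext fun x => (hf x).symm)
  · rw [Rels.comap_comap]
    refine congrArg (Rels.comap r₁) (funext fun x => ?_)
    cases x
    · exact hfy
    · exact hf _

theorem exists_mem (p : Approx) (y : ℕ) : ∃ q : Approx, p ≤ q ∧ y ∈ q.S := by
  by_cases hy : y ∈ p.S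
  · exact ⟨p, le_rfl, hy⟩
  -- A single point, amalgamated over the empty structure, provides some extension by one element.
  · have h0 : (⟨fun _ => True, fun _ _ => False, fun _ _ _ _ => False, fun _ _ _ _ => False⟩ :
        Rels (Option Empty)).IsZ := by
      refine ⟨by simp, by simp, by simp, by simp, fun t _ => ?_⟩
      exact (isCirc_congr (by simp) (by simp)).1 isCirc_empty
    obtain ⟨r₁, h1, h2, -⟩ := p.isZ.exists_amalgam (A := Empty) h0
      (σ := fun x => x.elim) (fun x => x.elim) (by ext x <;> exact x.elim)
    obtain ⟨q, hq, hyq, -⟩ := p.exists_extend hy h1 h2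
    exact ⟨q, hq, hyq⟩

theorem exists_finset_subset (p : Approx) (A : Finset ℕ) : ∃ q : Approx, p ≤ q ∧ A ⊆ q.S := by
  classical
  induction A using Finset.induction_on with
  | empty => exact ⟨p, le_rfl, by simp⟩
  | insert a A _ ih =>
    obtain ⟨q, hq, hA⟩ := ih
    obtain ⟨q', hq', ha⟩ := q.exists_mem a
    refine ⟨q', hq.trans hq', Finset.insert_subset ha (hA.trans hq'.1)⟩

/-- An extension problem over finitely many natural numbers. -/
abbrev Task := Σ n : ℕ, (Fin n → ℕ) × Rels (Option (Fin n))

/-- The approximations that decide a given extension problem. -/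
def solves (t : Task) : Set Approx :=
  {p | (∀ i, t.2.1 i ∈ p.S) ∧ (t.2.2.IsZ → Function.Injective t.2.1 →
    p.r.comap t.2.1 = t.2.2.comap some →
    ∃ y ∈ p.S, (∀ i, t.2.1 i ≠ y) ∧ p.r.comap (fun x => x.elim y t.2.1) = t.2.2)}

/-- Once the parameters belong to the approximation, the problem is either not admissible there, and
nothing is to be done, or it is amalgamated with the whole approximation and realized by a fresh
number. -/
theorem isCofinal_solves (t : Task) : IsCofinal (solves t) := by
  classical
  intro p
  obtain ⟨n, σ, r₀⟩ := t
  obtain ⟨q, hpq, hq⟩ := p.exists_finset_subset (Finset.univ.image σ)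
  have hσ : ∀ i, σ i ∈ q.S := fun i => hq (Finset.mem_image_of_mem _ (Finset.mem_univ i))
  by_cases h : r₀.IsZ ∧ Function.Injective σ ∧ q.r.comap σ = r₀.comap some
  · obtain ⟨h₀, hinj, hc⟩ := h
    obtain ⟨r₁, h1, h2, h3⟩ := q.isZ.exists_amalgam h₀ (σ := fun i => (⟨σ i, hσ i⟩ : q.S))
      (fun i j hij => hinj (by simpa using hij)) hc
    obtain ⟨y, hy⟩ := Infinite.exists_notMem_finset q.S
    obtain ⟨q', hq', hyq', hr⟩ := q.exists_extend hy h1 h2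
    refine ⟨q', ⟨fun i => hq'.1 (hσ i), fun _ _ _ => ⟨y, hyq', ?_, ?_⟩⟩, hpq.trans hq'⟩
    · rintro i rfl
      exact hy (hσ i)
    · rw [← h3, ← hr, Rels.comap_comap]
      refine congrArg (Rels.comap q'.r) (funext fun x => ?_)
      cases x <;> rfl
  · exact ⟨q, ⟨hσ, fun h1 h2 h3 => (h ⟨h1, h2, h3⟩).elim⟩, hpq⟩

end Approx

/-- Every axiom is a universal statement in at most five variables, so a failure would already show
on a finite subset. -/
theorem Rels.IsZ.of_fin {X : Type*} {r : Rels X}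
    (h : ∀ S : Finset X, (r.comap (fun x : S => (x : X))).IsZ) : r.IsZ := by
  classical
  have hC : ∀ a b c s, r.C a b c s → ¬ r.pt s ∧ r.E a s ∧ r.E b s ∧ r.E c s := fun a b c s h' =>
    (h {a, b, c, s}).C_dom' (a := ⟨a, by simp⟩) (b := ⟨b, by simp⟩) (c := ⟨c, by simp⟩)
      (s := ⟨s, by simp⟩) h'
  have hD : ∀ a b c t, r.D a b c t → r.pt t ∧ (¬ r.pt a ∧ ¬ r.E t a) ∧ (¬ r.pt b ∧ ¬ r.E t b) ∧
      (¬ r.pt c ∧ ¬ r.E t c) := fun a b c s h' =>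
    (h {a, b, c, s}).D_dom' (a := ⟨a, by simp⟩) (b := ⟨b, by simp⟩) (c := ⟨c, by simp⟩)
      (t := ⟨s, by simp⟩) h'
  refine ⟨fun t s h' => (h {t, s}).sorts ⟨t, by simp⟩ ⟨s, by simp⟩ h',
    fun a b c s h' => (hC _ _ _ _ h').1, fun a b c t h' => (hD _ _ _ _ h').1, fun s hs => ?_,
    fun t ht => ?_⟩
  · refine ⟨fun a b c h' => (hC _ _ _ _ h').2, fun a b c h' => ?_, fun a b c h' => ?_,
      fun a b c d h' => ?_, fun a b c ha hb hc hab hbc hac => ?_⟩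
    · exact ((h {a, b, c, s}).C_circ ⟨s, by simp⟩ hs).cyc ⟨a, by simp⟩ ⟨b, by simp⟩ ⟨c, by simp⟩ h'
    · exact ((h {a, b, c, s}).C_circ ⟨s, by simp⟩ hs).asymm ⟨a, by simp⟩ ⟨b, by simp⟩ ⟨c, by simp⟩ h'
    · exact ((h {a, b, c, d, s}).C_circ ⟨s, by simp⟩ hs).trans ⟨a, by simp⟩ ⟨b, by simp⟩
        ⟨c, by simp⟩ ⟨d, by simp⟩ h'
    · exact ((h {a, b, c, s}).C_circ ⟨s, by simp⟩ hs).total ⟨a, by simp⟩ ⟨b, by simp⟩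
        ⟨c, by simp⟩ ha hb hc (by simpa using hab) (by simpa using hbc) (by simpa using hac)
  · refine ⟨fun a b c h' => (hD _ _ _ _ h').2, fun a b c h' => ?_, fun a b c h' => ?_,
      fun a b c d h' => ?_, fun a b c ha hb hc hab hbc hac => ?_⟩
    · exact ((h {a, b, c, t}).D_circ ⟨t, by simp⟩ ht).cyc ⟨a, by simp⟩ ⟨b, by simp⟩ ⟨c, by simp⟩ h'
    · exact ((h {a, b, c, t}).D_circ ⟨t, by simp⟩ ht).asymm ⟨a, by simp⟩ ⟨b, by simp⟩ ⟨c, by simp⟩ h'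
    · exact ((h {a, b, c, d, t}).D_circ ⟨t, by simp⟩ ht).trans ⟨a, by simp⟩ ⟨b, by simp⟩
        ⟨c, by simp⟩ ⟨d, by simp⟩ h'
    · exact ((h {a, b, c, t}).D_circ ⟨t, by simp⟩ ht).total ⟨a, by simp⟩ ⟨b, by simp⟩
        ⟨c, by simp⟩ ha hb hc (by simpa using hab) (by simpa using hbc) (by simpa using hac)

/-- The generic structure on `ℕ`. -/
theorem exists_generic : ∃ r : Rels ℕ, r.IsZ ∧ r.HasExt ℵ₀ := by
  classical
  have : Encodable Approx.Task := Encodable.ofCountable _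
  let p₀ : Approx := ⟨∅, ⟨fun _ => True, fun _ _ => False, fun _ _ _ _ => False,
    fun _ _ _ _ => False⟩, by
      refine ⟨by simp [Rels.comap], by simp [Rels.comap], by simp [Rels.comap],
        fun s _ => ?_, fun t _ => ?_⟩ <;> first | exact absurd s.2 (Finset.notMem_empty _) | exact absurd t.2 (Finset.notMem_empty _)⟩
  -- There are countably many tasks, so one ideal meets all the cofinal sets (Rasiowa–Sikorski).
  let I := Order.idealOfCofinals p₀ (fun t => ⟨Approx.solves t, Approx.isCofinal_solves t⟩)
  have hI : ∀ t, ∃ q ∈ Approx.solves t, q ∈ I := fun t =>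
    Order.cofinal_meets_idealOfCofinals p₀
      (fun t => ⟨Approx.solves t, Approx.isCofinal_solves t⟩) t
  have hdir : ∀ p ∈ I, ∀ q ∈ I, ∃ s ∈ I, p ≤ s ∧ q ≤ s := I.directed
  have hcover : ∀ A : Finset ℕ, ∃ q ∈ I, A ⊆ q.S := by
    intro A
    induction A using Finset.induction_on with
    | empty => exact ⟨p₀, Order.mem_idealOfCofinals _ _, by simp⟩
    | insert a A _ ih =>
      obtain ⟨q, hq, hA⟩ := ih
      -- Any task with parameter `a` forces `a` into the approximation; the relations chosen here
      -- are irrelevant.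
      obtain ⟨q', h1, h2⟩ := hI ⟨1, fun _ => a, ⟨fun _ => True, fun _ _ => False,
        fun _ _ _ _ => False, fun _ _ _ _ => False⟩⟩
      obtain ⟨s, hs, hs1, hs2⟩ := hdir q hq q' h2
      exact ⟨s, hs, Finset.insert_subset (hs2.1 (h1.1 0)) (hA.trans hs1.1)⟩
  choose Q hQ hQS using hcover
  -- The union of the ideal: each tuple is judged by some approximation containing it, and
  -- directedness makes the choice immaterial.
  let r : Rels ℕ := ⟨fun a => (Q {a}).r.pt a, fun a b => (Q {a, b}).r.E a b,
    fun a b c d => (Q {a, b, c, d}).r.C a b c d, fun a b c d => (Q {a, b, c, d}).r.D a b c d⟩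
  have hr : ∀ p ∈ I, ∀ {A : Type} (f : A → ℕ), (∀ a, f a ∈ p.S) → r.comap f = p.r.comap f := by
    intro p hp A f hf
    have key : ∀ (B : Finset ℕ), (∀ b ∈ B, b ∈ p.S) →
        (Q B).r.comap (fun x : B => (x : ℕ)) = p.r.comap (fun x : B => (x : ℕ)) := by
      intro B hB
      obtain ⟨s, hs, h1, h2⟩ := hdir _ (hQ B) p hp
      rw [Approx.comap_eq h1 _ (fun x => hQS B x.2), Approx.comap_eq h2 _ (fun x => hB _ x.2)]
    refine Rels.ext (funext fun a => ?_) (funext fun a => funext fun b => ?_)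
      (funext fun a => funext fun b => funext fun c => funext fun d => ?_)
      (funext fun a => funext fun b => funext fun c => funext fun d => ?_)
    · exact congrFun (congrArg Rels.pt (key {f a} (by simp [hf]))) ⟨f a, by simp⟩
    · exact congrFun (congrFun (congrArg Rels.E (key {f a, f b} (by simp [hf])))
        ⟨f a, by simp⟩) ⟨f b, by simp⟩
    · exact congrFun (congrFun (congrFun (congrFun (congrArg Rels.C
        (key {f a, f b, f c, f d} (by simp [hf]))) ⟨f a, by simp⟩) ⟨f b, by simp⟩)
          ⟨f c, by simp⟩) ⟨f d, by simp⟩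
    · exact congrFun (congrFun (congrFun (congrFun (congrArg Rels.D
        (key {f a, f b, f c, f d} (by simp [hf]))) ⟨f a, by simp⟩) ⟨f b, by simp⟩)
          ⟨f c, by simp⟩) ⟨f d, by simp⟩
  refine ⟨r, Rels.IsZ.of_fin fun S => ?_, Rels.hasExt_aleph0_of_fin fun n r₀ h₀ σ hσ hc => ?_⟩
  · rw [hr _ (hQ S) _ (fun x => hQS S x.2)]
    exact (Q S).isZ.comap (f := fun x : S => (⟨x, hQS S x.2⟩ : (Q S).S))
      (fun x y h => Subtype.ext (by simpa using h))
  · obtain ⟨q, ⟨h1, h2⟩, hq⟩ := hI ⟨n, σ, r₀⟩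
    obtain ⟨y, hy, hy1, hy2⟩ := h2 h₀ hσ (by rw [← hr q hq σ h1, hc])
    refine ⟨y, hy1, ?_⟩
    rw [hr q hq _ (by rintro (_ | x); exacts [hy, h1 x]), hy2]

/-! ### Translation between bare relations and `Lang`-structures -/

theorem isCircularOrderOn_iff {X : Type u} {R : X → X → X → Prop} {A : Set X}
    (hdom : ∀ a b c, R a b c → a ∈ A ∧ b ∈ A ∧ c ∈ A) :
    IsCircularOrderOn R A ↔ IsCirc (fun x => x ∈ A) R := by
  constructor
  · rintro ⟨o, ho⟩
    refine ⟨hdom, fun a b c h => ?_, fun a b c h h' => ?_, fun a b c d h h' => ?_,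
      fun a b c ha hb hc hab hbc hac => ?_⟩
    · obtain ⟨ha, hb, hc⟩ := hdom _ _ _ h
      exact (ho ⟨b, hb⟩ ⟨c, hc⟩ ⟨a, ha⟩).2 (sbtw_cyclic_left ((ho ⟨a, ha⟩ ⟨b, hb⟩ ⟨c, hc⟩).1 h))
    · obtain ⟨ha, hb, hc⟩ := hdom _ _ _ h
      exact sbtw_asymm ((ho ⟨a, ha⟩ ⟨b, hb⟩ ⟨c, hc⟩).1 h) ((ho ⟨c, hc⟩ ⟨b, hb⟩ ⟨a, ha⟩).1 h')
    · obtain ⟨ha, hb, hc⟩ := hdom _ _ _ h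
      obtain ⟨-, hd, -⟩ := hdom _ _ _ h'
      exact (ho ⟨a, ha⟩ ⟨d, hd⟩ ⟨c, hc⟩).2 (sbtw_trans_left
        ((ho ⟨a, ha⟩ ⟨b, hb⟩ ⟨c, hc⟩).1 h) ((ho ⟨b, hb⟩ ⟨d, hd⟩ ⟨c, hc⟩).1 h'))
    · by_contra hn
      rw [not_or] at hn
      have h1 := mt (ho ⟨a, ha⟩ ⟨b, hb⟩ ⟨c, hc⟩).2 hn.1
      have h2 := mt (ho ⟨c, hc⟩ ⟨b, hb⟩ ⟨a, ha⟩).2 hn.2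
      rw [sbtw_iff_not_btw, not_not] at h1 h2
      rcases btw_antisymm h2 h1 with h | h | h
      · exact hab (congrArg Subtype.val h)
      · exact hbc (congrArg Subtype.val h)
      · exact hac (congrArg Subtype.val h).symm
  · intro h
    have hT := h.comap (f := fun x : A => (x : X)) Subtype.val_injective
    let o : CircularOrder A :=
      { btw := fun a b c => ¬ R c b a
        sbtw := fun a b c => R a b c
        btw_refl := fun a h' => (h.ne h').1 rfl
        btw_cyclic_left := fun {a b c} h1 h2 => h1 (h.cyc _ _ _ h2)
        sbtw_iff_btw_not_btw := fun {a b c} =>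
          ⟨fun h1 => ⟨h.asymm _ _ _ h1, not_not.2 h1⟩, fun h1 => not_not.1 h1.2⟩
        sbtw_trans_left := fun {a b c d} h1 h2 => h.trans _ _ _ _ h1 h2
        btw_antisymm := fun {a b c} h1 h2 => by
          by_contra hn
          simp only [not_or] at hn
          rcases hT.total a b c a.2 b.2 c.2 hn.1 hn.2.1 (Ne.symm hn.2.2) with h3 | h3
          · exact h2 h3
          · exact h1 h3
        btw_total := fun a b c => by
          by_contra hn
          simp only [not_or, not_not] at hn
          exact h.asymm _ _ _ hn.1 hn.2 }
    exact ⟨o, fun a b c => Iff.rfl⟩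

section

variable (X : Type u) [Lang.Structure X]

/-- The relations of an `L`-structure. -/
def rels : Rels X := ⟨IsPoint, E, C, D⟩

variable {X}

theorem isZiegler_iff : IsZiegler X ↔ (rels X).IsZ := by
  constructor
  · intro h
    refine ⟨h.E_sorts, fun a b c s h' => (h.E_sorts _ _ (h.C_domain _ _ _ _ h').1).2,
      fun a b c t h' => (h.D_domain _ _ _ _ h').1, fun s hs => ?_, fun t ht => ?_⟩
    · exact (isCircularOrderOn_iff fun _ _ _ h' => h.C_domain _ _ _ _ h').1 (h.C_circular s hs)
    · exact (isCircularOrderOn_iff (R := fun a b c => D a b c t) (A := {s | IsSet s ∧ ¬ E t s})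
        fun _ _ _ h' => (h.D_domain _ _ _ _ h').2).1 (h.D_circular t ht)
  · intro h
    refine ⟨h.sorts, fun a b c s h' => (h.C_dom' h').2, fun s hs => ?_,
      fun a b c t h' => h.D_dom' h', fun t ht => ?_⟩
    · exact (isCircularOrderOn_iff (R := fun a b c => C a b c s) (A := {t | E t s})
        fun _ _ _ h' => (h.C_dom' h').2).2 (h.C_circ s hs)
    · exact (isCircularOrderOn_iff (R := fun a b c => D a b c t) (A := {s | IsSet s ∧ ¬ E t s})
        fun _ _ _ h' => (h.D_dom' h').2).2 (h.D_circ t ht)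

/-- The `L`-structure with given relations. -/
@[reducible] def Rels.toStructure {X : Type u} (r : Rels X) : Lang.Structure X where
  funMap f := isEmptyElim f
  RelMap {_} R := match R with
    | .point => fun x => r.pt (x 0)
    | .mem => fun x => r.E (x 0) (x 1)
    | .C => fun x => r.C (x 0) (x 1) (x 2) (x 3)
    | .D => fun x => r.D (x 0) (x 1) (x 2) (x 3)

theorem relMap_point (x : Fin 1 → X) :
    FirstOrder.Language.Structure.RelMap pointSym x ↔ (rels X).pt (x 0) := by
  have : x = ![x 0] := by funext i; fin_cases i; rfl
  conv_lhs => rw [this]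
  exact Iff.rfl

theorem relMap_mem (x : Fin 2 → X) :
    FirstOrder.Language.Structure.RelMap memSym x ↔ (rels X).E (x 0) (x 1) := by
  have : x = ![x 0, x 1] := by funext i; fin_cases i <;> rfl
  conv_lhs => rw [this]
  exact Iff.rfl

theorem relMap_C (x : Fin 4 → X) :
    FirstOrder.Language.Structure.RelMap cSym x ↔ (rels X).C (x 0) (x 1) (x 2) (x 3) := by
  have : x = ![x 0, x 1, x 2, x 3] := by funext i; fin_cases i <;> rfl
  conv_lhs => rw [this]
  exact Iff.rfl

theorem relMap_D (x : Fin 4 → X) :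
    FirstOrder.Language.Structure.RelMap dSym x ↔ (rels X).D (x 0) (x 1) (x 2) (x 3) := by
  have : x = ![x 0, x 1, x 2, x 3] := by funext i; fin_cases i <;> rfl
  conv_lhs => rw [this]
  exact Iff.rfl

variable {Y : Type w} [Lang.Structure Y]

theorem comap_rels_embedding (f : X ↪[Lang] Y) : (rels Y).comap f = rels X := by
  have hf : ∀ {n : ℕ} (R : Lang.Relations n) (x : Fin n → X),
    FirstOrder.Language.Structure.RelMap R (f ∘ x) ↔ FirstOrder.Language.Structure.RelMap R x :=
    fun R x => FirstOrder.Language.Embedding.map_rel f R x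
  refine Rels.ext (funext fun a => propext ?_) (funext fun a => funext fun b => propext ?_)
    (funext fun a => funext fun b => funext fun c => funext fun d => propext ?_)
    (funext fun a => funext fun b => funext fun c => funext fun d => propext ?_)
  · have := hf pointSym ![a]
    rwa [relMap_point, relMap_point] at this
  · have := hf memSym ![a, b]
    rwa [relMap_mem, relMap_mem] at this
  · have := hf cSym ![a, b, c, d]
    rwa [relMap_C, relMap_C] at this
  · have := hf dSym ![a, b, c, d]
    rwa [relMap_D, relMap_D] at this

/-- An injective map compatible with the relations is an embedding. -/
def embeddingOfComap (f : X → Y) (hf : Function.Injective f) (h : (rels Y).comap f = rels X) :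
    X ↪[Lang] Y where
  toFun := f
  inj' := hf
  map_fun' g := isEmptyElim g
  map_rel' := by
    intro n R x
    cases R with
    | point =>
      refine (relMap_point (f ∘ x)).trans (Iff.trans ?_ (relMap_point x).symm)
      rw [← h]; exact Iff.rfl
    | mem =>
      refine (relMap_mem (f ∘ x)).trans (Iff.trans ?_ (relMap_mem x).symm)
      rw [← h]; exact Iff.rfl
    | C =>
      refine (relMap_C (f ∘ x)).trans (Iff.trans ?_ (relMap_C x).symm)
      rw [← h]; exact Iff.rfl
    | D =>
      refine (relMap_D (f ∘ x)).trans (Iff.trans ?_ (relMap_D x).symm)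
      rw [← h]; exact Iff.rfl

end

/-! ### The extension property and Fraïssé limits -/

theorem structure_fg_iff_finite {X : Type u} [Lang.Structure X] :
    FirstOrder.Language.Structure.FG Lang X ↔ Finite X := by
  have : FirstOrder.Language.IsRelational Lang := fun n => inferInstance
  exact FirstOrder.Language.Structure.fg_iff_finite

theorem substructure_fg_iff_finite {X : Type u} [Lang.Structure X] {S : Lang.Substructure X} :
    S.FG ↔ Finite S := by
  rw [FirstOrder.Language.Substructure.fg_iff_structure_fg, structure_fg_iff_finite]

/-- In a relational language, adjoining `m` to a finite substructure adds only the element `m`, so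
extending a finite partial embedding to `m` is a one-point extension problem. -/
theorem isExtensionPair {X N : Type u} [Lang.Structure X] [Lang.Structure N] (hX : (rels X).IsZ)
    (hN : (rels N).HasExt ℵ₀) : Lang.IsExtensionPair X N := by
  classical
  rw [FirstOrder.Language.isExtensionPair_iff_exists_embedding_closure_singleton_sup]
  intro S hS f m
  have : Finite S := substructure_fg_iff_finite.1 hS
  have hfS : (rels N).comap f = (rels X).comap (fun x : S => (x : X)) := by
    rw [comap_rels_embedding f]
    exact (comap_rels_embedding S.subtype).symm
  have hsup : ∀ x : (FirstOrder.Language.Substructure.closure Lang {m} ⊔ S : Lang.Substructure X),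
      (x : X) = m ∨ (x : X) ∈ S := by
    intro x
    have hle : (FirstOrder.Language.Substructure.closure Lang {m} ⊔ S : Lang.Substructure X) ≤
        ⟨insert m (S : Set X), fun g => isEmptyElim g⟩ := by
      refine sup_le ?_ ?_
      · rw [FirstOrder.Language.Substructure.closure_le]
        intro y hy
        exact Or.inl hy
      · intro y hy
        exact Or.inr hy
    exact hle x.2
  by_cases hm : m ∈ S
  · have hle : (FirstOrder.Language.Substructure.closure Lang {m} ⊔ S : Lang.Substructure X) ≤ S :=
      sup_le ((FirstOrder.Language.Substructure.closure_le).2 (by simpa using hm)) le_rfl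
    refine ⟨f.comp (FirstOrder.Language.Substructure.inclusion hle), ?_⟩
    ext x
    rfl
  · let j : Option S → X := fun x => x.elim m (fun x => (x : X))
    have hj : Function.Injective j := by
      rintro (_ | a) (_ | b) hab
      · rfl
      · exact (hm (by simp only [j, Option.elim] at hab; rw [hab]; exact b.2)).elim
      · exact (hm (by simp only [j, Option.elim] at hab; rw [← hab]; exact a.2)).elim
      · exact congrArg some (Subtype.ext hab)
    obtain ⟨z, hz, hz'⟩ := hN S (Cardinal.lt_aleph0_of_finite S) ((rels X).comap j) (hX.comap hj) f
      f.injective hfS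
    let k : (FirstOrder.Language.Substructure.closure Lang {m} ⊔ S : Lang.Substructure X) →
      Option S := fun x => if h : (x : X) ∈ S then some ⟨x, h⟩ else none
    have hjk : ∀ x, j (k x) = x := by
      intro x
      by_cases h : (x : X) ∈ S
      · simp [j, k, h]
      · simpa [j, k, h] using ((hsup x).resolve_right h).symm
    have hkinj : Function.Injective k := fun x y hxy => Subtype.ext (by
      rw [← hjk x, ← hjk y, hxy])
    have hginj : Function.Injective (fun x : Option S => x.elim z f) := by
      rintro (_ | a) (_ | b) hab
      · rfl
      · exact (hz b hab.symm).elim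
      · exact (hz a hab).elim
      · exact congrArg some (f.injective hab)
    refine ⟨embeddingOfComap (fun x => (k x).elim z f) (hginj.comp hkinj) ?_, ?_⟩
    · have := congrArg (fun r => Rels.comap r k) hz'
      simp only [Rels.comap_comap] at this
      rw [this]
      simp only [hjk]
      exact comap_rels_embedding (FirstOrder.Language.Substructure.subtype _)
    · ext x
      have : k (FirstOrder.Language.Substructure.inclusion le_sup_right x) = some x := by
        simp [k]
      change f x = (k (FirstOrder.Language.Substructure.inclusion le_sup_right x)).elim z f
      rw [this]
      rfl

theorem nonempty_fgEquiv (X : Type u) (Y : Type v) [Lang.Structure X] [Lang.Structure Y] :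
    Nonempty (Lang.FGEquiv X Y) := by
  have : IsEmpty (⊥ : Lang.Substructure X) := by
    have hle : (⊥ : Lang.Substructure X) ≤ ⟨∅, fun g => isEmptyElim g⟩ := bot_le
    exact ⟨fun x => (hle x.2).elim⟩
  let f : (⊥ : Lang.Substructure X) ↪[Lang] Y := embeddingOfComap (fun x => isEmptyElim x)
    (fun x => isEmptyElim x) (by ext x <;> exact isEmptyElim x)
  exact ⟨⟨⟨⊥, f.toHom.range, f.equivRange⟩, FirstOrder.Language.Substructure.fg_bot⟩⟩

/-- Back and forth between `F` and itself gives ultrahomogeneity; going forth only, from a finite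
member of the class into `F`, gives the age. -/
theorem isFraisseLimit_of_hasExt {F : Type u} [Lang.Structure F] [Countable F]
    (hZ : (rels F).IsZ) (hF : (rels F).HasExt ℵ₀) :
    FirstOrder.Language.IsFraisseLimit finiteClass.{u} F where
  ultrahomogeneous := (FirstOrder.Language.isUltrahomogeneous_iff_IsExtensionPair
    FirstOrder.Language.Structure.cg_of_countable).2 (isExtensionPair hZ hF)
  age := by
    ext X
    constructor
    · rintro ⟨h1, ⟨f⟩⟩
      refine ⟨structure_fg_iff_finite.1 h1, isZiegler_iff.2 ?_⟩
      rw [← comap_rels_embedding f]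
      exact hZ.comap f.injective
    · rintro ⟨h1, h2⟩
      have : Finite X := h1
      refine ⟨structure_fg_iff_finite.2 h1, ?_⟩
      obtain ⟨g, -⟩ := FirstOrder.Language.embedding_from_cg
        (FirstOrder.Language.Structure.cg_of_countable) (nonempty_fgEquiv X F).some
        (isExtensionPair (isZiegler_iff.1 h2) hF)
      exact ⟨g⟩

theorem exists_isFraisseLimit : ∃ (F : Type u) (_ : Lang.Structure F) (_ : Countable F),
    FirstOrder.Language.IsFraisseLimit finiteClass.{u} F := by
  obtain ⟨r, hr, hext⟩ := exists_generic
  let r' : Rels (ULift.{u} ℕ) := r.comap ULift.down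
  let s := r'.toStructure
  refine ⟨ULift.{u} ℕ, s, inferInstance, isFraisseLimit_of_hasExt
    (hr.comap ULift.down_injective) (Rels.hasExt_aleph0_of_fin ?_)⟩
  intro n r₀ h₀ σ hσ hc
  obtain ⟨z, hz, hz'⟩ := hext (Fin n) (Cardinal.lt_aleph0_of_finite _) r₀ h₀ (fun i => (σ i).down)
    (ULift.down_injective.comp hσ) hc
  refine ⟨⟨z⟩, fun a h => hz a (by rw [h]), ?_⟩
  rw [← hz']
  change r.comap _ = r.comap _
  congr 1
  funext x
  cases x <;> rfl

theorem isZ_of_isFraisseLimit {F : Type u} [Lang.Structure F] [Countable F]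
    (h : FirstOrder.Language.IsFraisseLimit finiteClass.{u} F) : (rels F).IsZ := by
  refine Rels.IsZ.of_fin fun S => ?_
  let S' : Lang.Substructure F := ⟨(S : Set F), fun g => isEmptyElim g⟩
  have hfin : Finite S' := inferInstanceAs (Finite S)
  have : (⟨S', inferInstance⟩ : CategoryTheory.Bundled Lang.Structure) ∈ finiteClass := by
    rw [← h.age]
    exact ⟨structure_fg_iff_finite.2 hfin, ⟨S'.subtype⟩⟩
  have := isZiegler_iff.1 this.2
  rw [← comap_rels_embedding S'.subtype] at this
  exact this

/-- The extension problem is itself a member of the class, so it embeds in `F`; ultrahomogeneity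
moves the copy so that it agrees with `σ` on `A`. -/
theorem hasExt_of_isFraisseLimit {F : Type u} [Lang.Structure F] [Countable F]
    (h : FirstOrder.Language.IsFraisseLimit finiteClass.{u} F) : (rels F).HasExt ℵ₀ := by
  intro A hA r₀ h₀ σ hσ hc
  have : Finite A := Cardinal.lt_aleph0_iff_finite.1 hA
  let s₁ := (r₀.comap some).toStructure
  let s₂ := r₀.toStructure
  have hmem : (⟨Option A, s₂⟩ : CategoryTheory.Bundled Lang.Structure) ∈ finiteClass :=
    ⟨inferInstanceAs (Finite (Option A)), isZiegler_iff.2 h₀⟩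
  rw [← h.age] at hmem
  have hne : Nonempty (Option A ↪[Lang] F) := hmem.2
  obtain ⟨f, hf⟩ := h.ultrahomogeneous.extend_embedding (structure_fg_iff_finite.2 this)
    (embeddingOfComap σ hσ hc)
    (embeddingOfComap (X := A) (Y := Option A) some (Option.some_injective A) rfl)
  have hf' : ∀ a, σ a = f (some a) := fun a => congrArg (fun g => g a) hf
  refine ⟨f none, fun a ha => ?_, ?_⟩
  · rw [hf'] at ha
    exact absurd (f.injective ha) (by simp)
  · have h3 : (fun x : Option A => x.elim (f none) σ) = f := by
      funext x
      cases x
      · rfl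
      · exact hf' _
    rw [h3]
    exact comap_rels_embedding f

/-! ### Transfer to models of the theory, patterns, quantifier elimination, categoricity -/

section Transfer

variable {L : FirstOrder.Language.{u, v}} {F : Type w} [L.Structure F] {N : Type*} [L.Structure N]
  [N ⊨ L.completeTheory F]

theorem realize_of_forall_realize {ι : Type*} [Finite ι] (φ : L.Formula ι)
    (h : ∀ v : ι → F, φ.Realize v) (v : ι → N) : φ.Realize v := by
  let ψ : L.Sentence := FirstOrder.Language.Formula.iAlls ι (φ.relabel Sum.inr)
  have h1 : F ⊨ ψ := by
    refine FirstOrder.Language.Formula.realize_iAlls.2 fun i => ?_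
    rw [FirstOrder.Language.Formula.realize_relabel]
    exact h _
  have h2 : N ⊨ ψ := FirstOrder.Language.Theory.realize_sentence_of_mem (L.completeTheory F)
    (FirstOrder.Language.mem_completeTheory.2 h1)
  have h3 := FirstOrder.Language.Formula.realize_iAlls.1 h2 v
  rw [FirstOrder.Language.Formula.realize_relabel] at h3
  exact h3

theorem exists_realize_of_realize {ι : Type*} [Finite ι] (φ : L.Formula ι) {v : ι → N}
    (h : φ.Realize v) : ∃ v : ι → F, φ.Realize v := by
  by_contra hn
  push Not at hn
  exact realize_of_forall_realize φ.not hn v h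

end Transfer

section Pattern

variable {X : Type*} [Lang.Structure X] {Y : Type*} [Lang.Structure Y] {ι : Type*}

/-- The atomic data of a tuple. -/
abbrev Pattern (ι : Type*) := Rels ι × (ι → ι → Prop)

/-- The relations and equalities between the entries of a tuple. -/
def pattern (v : ι → X) : Pattern ι := ((rels X).comap v, fun i j => v i = v j)

/-- The quantifier-free formula with prescribed truth value `c` built from `φ`. -/
noncomputable def literal {L : FirstOrder.Language} (c : Prop) (φ : L.Formula ι) : L.Formula ι :=
  open Classical in if c then φ else φ.not

theorem realize_literal {L : FirstOrder.Language} {X : Type*} [L.Structure X] {c : Prop}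
    {φ : L.Formula ι} {v : ι → X} : (literal c φ).Realize v ↔ (φ.Realize v ↔ c) := by
  unfold literal
  split_ifs with h <;> simp [h]

theorem isQF_literal {L : FirstOrder.Language} {c : Prop} {φ : L.Formula ι}
    (h : FirstOrder.Language.BoundedFormula.IsQF φ) :
    FirstOrder.Language.BoundedFormula.IsQF (literal c φ) := by
  unfold literal
  split_ifs
  · exact h
  · exact h.not

theorem isQF_iInf {L : FirstOrder.Language} {β : Type*} [Finite β] {f : β → L.Formula ι}
    (h : ∀ b, FirstOrder.Language.BoundedFormula.IsQF (f b)) :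
    FirstOrder.Language.BoundedFormula.IsQF (FirstOrder.Language.Formula.iInf f) := by
  unfold FirstOrder.Language.Formula.iInf FirstOrder.Language.BoundedFormula.iInf
  simp only
  generalize Finset.toList _ = l
  induction l with
  | nil => exact FirstOrder.Language.BoundedFormula.IsQF.top
  | cons b l ih => exact (h b).inf ih

theorem isQF_iSup {L : FirstOrder.Language} {β : Type*} [Finite β] {f : β → L.Formula ι}
    (h : ∀ b, FirstOrder.Language.BoundedFormula.IsQF (f b)) :
    FirstOrder.Language.BoundedFormula.IsQF (FirstOrder.Language.Formula.iSup f) := by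
  unfold FirstOrder.Language.Formula.iSup FirstOrder.Language.BoundedFormula.iSup
  simp only
  generalize Finset.toList _ = l
  induction l with
  | nil => exact FirstOrder.Language.BoundedFormula.isQF_bot
  | cons b l ih => exact (h b).sup ih

/-- The atomic formula `R(x_{f 0}, …, x_{f (n - 1)})`. -/
def relFormula {n : ℕ} (R : Lang.Relations n) (f : Fin n → ι) : Lang.Formula ι :=
  R.formula fun i => FirstOrder.Language.Term.var (f i)

theorem realize_relFormula {n : ℕ} {R : Lang.Relations n} {f : Fin n → ι} {v : ι → X} :
    (relFormula R f).Realize v ↔ FirstOrder.Language.Structure.RelMap R (fun i => v (f i)) :=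
  FirstOrder.Language.Formula.realize_rel

theorem isQF_relFormula {n : ℕ} (R : Lang.Relations n) (f : Fin n → ι) :
    FirstOrder.Language.BoundedFormula.IsQF (relFormula R f) :=
  (FirstOrder.Language.BoundedFormula.IsAtomic.rel _ _).isQF

/-- The formula isolating a pattern. -/
noncomputable def patternFormula [Finite ι] (p : Pattern ι) : Lang.Formula ι :=
  FirstOrder.Language.Formula.iInf (fun i : ι => literal (p.1.pt i) (relFormula pointSym ![i])) ⊓
  FirstOrder.Language.Formula.iInf (fun i : ι × ι =>
    literal (p.1.E i.1 i.2) (relFormula memSym ![i.1, i.2])) ⊓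
  FirstOrder.Language.Formula.iInf (fun i : ι × ι × ι × ι =>
    literal (p.1.C i.1 i.2.1 i.2.2.1 i.2.2.2) (relFormula cSym ![i.1, i.2.1, i.2.2.1, i.2.2.2])) ⊓
  FirstOrder.Language.Formula.iInf (fun i : ι × ι × ι × ι =>
    literal (p.1.D i.1 i.2.1 i.2.2.1 i.2.2.2) (relFormula dSym ![i.1, i.2.1, i.2.2.1, i.2.2.2])) ⊓
  FirstOrder.Language.Formula.iInf (fun i : ι × ι => literal (p.2 i.1 i.2)
    (FirstOrder.Language.Term.equal (FirstOrder.Language.Term.var i.1)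
      (FirstOrder.Language.Term.var i.2)))

theorem isQF_patternFormula [Finite ι] (p : Pattern ι) :
    FirstOrder.Language.BoundedFormula.IsQF (patternFormula p) := by
  refine ((((isQF_iInf fun _ => ?_).inf (isQF_iInf fun _ => ?_)).inf (isQF_iInf fun _ => ?_)).inf
    (isQF_iInf fun _ => ?_)).inf (isQF_iInf fun _ => ?_)
  iterate 4 exact isQF_literal (isQF_relFormula _ _)
  exact isQF_literal (FirstOrder.Language.BoundedFormula.IsAtomic.equal _ _).isQF

theorem realize_patternFormula [Finite ι] {p : Pattern ι} {v : ι → X} :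
    (patternFormula p).Realize v ↔ pattern v = p := by
  simp only [patternFormula, FirstOrder.Language.Formula.realize_inf,
    FirstOrder.Language.Formula.realize_iInf, realize_literal, realize_relFormula, relMap_point,
    relMap_mem, relMap_C, relMap_D, FirstOrder.Language.Formula.realize_equal,
    FirstOrder.Language.Term.realize_var]
  constructor
  · rintro ⟨⟨⟨⟨h1, h2⟩, h3⟩, h4⟩, h5⟩
    refine Prod.ext (Rels.ext (funext fun i => propext (h1 i))
      (funext fun i => funext fun j => propext (h2 (i, j)))
      (funext fun i => funext fun j => funext fun k => funext fun l => propext (h3 (i, j, k, l)))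
      (funext fun i => funext fun j => funext fun k => funext fun l => propext (h4 (i, j, k, l))))
      (funext fun i => funext fun j => propext (h5 (i, j)))
  · rintro rfl
    exact ⟨⟨⟨⟨fun _ => Iff.rfl, fun _ => Iff.rfl⟩, fun _ => Iff.rfl⟩, fun _ => Iff.rfl⟩,
      fun _ => Iff.rfl⟩

/-- The formula defining a set of patterns. -/
noncomputable def patternsFormula [Finite ι] (S : Set (Pattern ι)) : Lang.Formula ι :=
  FirstOrder.Language.Formula.iSup (fun p : S => patternFormula (p : Pattern ι))

theorem realize_patternsFormula [Finite ι] {S : Set (Pattern ι)} {v : ι → X} :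
    (patternsFormula S).Realize v ↔ pattern v ∈ S := by
  simp [patternsFormula, FirstOrder.Language.Formula.realize_iSup, realize_patternFormula]

theorem isQF_patternsFormula [Finite ι] (S : Set (Pattern ι)) :
    FirstOrder.Language.BoundedFormula.IsQF (patternsFormula S) :=
  isQF_iSup fun _ => isQF_patternFormula _

theorem pattern_eq_iff {v : ι → X} {w : ι → Y} :
    pattern v = pattern w ↔ (rels X).comap v = (rels Y).comap w ∧ ∀ i j, v i = v j ↔ w i = w j := by
  simp only [pattern, Prod.mk.injEq]
  refine and_congr Iff.rfl ⟨fun h i j => iff_of_eq (congrFun (congrFun h i) j), fun h => ?_⟩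
  exact funext fun i => funext fun j => propext (h i j)

end Pattern

section Limit

variable {F : Type u} [Lang.Structure F] [Countable F]

/-- Equality of patterns says exactly that `v i ↦ w i` is a well-defined isomorphism between finite
substructures. -/
theorem exists_equiv_of_pattern_eq
    (hF : FirstOrder.Language.IsFraisseLimit finiteClass.{u} F) {ι : Type*} [Finite ι]
    {v w : ι → F} (h : pattern v = pattern w) : ∃ g : F ≃[Lang] F, ∀ i, g (v i) = w i := by
  obtain ⟨h1, h2⟩ := pattern_eq_iff.1 h
  let S : Lang.Substructure F := ⟨Set.range v, fun g => isEmptyElim g⟩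
  have hS : S.FG := substructure_fg_iff_finite.2 (inferInstanceAs (Finite (Set.range v)))
  have hc : ∀ x : S, ∃ i, v i = x := fun x => x.2
  choose k hk using hc
  have hinj : Function.Injective (fun x : S => w (k x)) := fun x y hxy => Subtype.ext (by
    rw [← hk x, ← hk y]
    exact (h2 _ _).2 hxy)
  have hcomap : (rels F).comap (fun x : S => w (k x)) = rels S := by
    have := congrArg (fun r => Rels.comap r k) h1
    simp only [Rels.comap_comap, hk] at this
    rw [← this]
    exact comap_rels_embedding S.subtype
  obtain ⟨g, hg⟩ := hF.ultrahomogeneous S hS (embeddingOfComap _ hinj hcomap)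
  refine ⟨g, fun i => ?_⟩
  have h3 : w (k ⟨v i, i, rfl⟩) = g (v i) := congrArg (fun f => f ⟨v i, i, rfl⟩) hg
  rw [← h3]
  exact (h2 _ _).1 (hk ⟨v i, i, rfl⟩)

/-- In models of the theory of the limit, formulas are determined by patterns. -/
theorem exists_patterns (hF : FirstOrder.Language.IsFraisseLimit finiteClass.{u} F) {ι : Type*}
    [Finite ι] (φ : Lang.Formula ι) : ∃ S : Set (Pattern ι), ∀ (N : Type w) [Lang.Structure N]
      [N ⊨ Lang.completeTheory F] (v : ι → N), φ.Realize v ↔ (patternsFormula S).Realize v := by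
  -- This set is computed in `F` alone; its equivalence with `φ` is proved in `F` by automorphisms
  -- and then transferred to `N`.
  refine ⟨{p | ∃ v : ι → F, pattern v = p ∧ φ.Realize v}, fun N _ _ v => ?_⟩
  refine FirstOrder.Language.BoundedFormula.realize_iff.1
    (realize_of_forall_realize (F := F) (φ.iff (patternsFormula _)) (fun v => ?_) v)
  refine FirstOrder.Language.BoundedFormula.realize_iff.2 ?_
  refine Iff.trans ?_ realize_patternsFormula.symm
  constructor
  · exact fun h => ⟨v, rfl, h⟩
  · rintro ⟨w, hw, h⟩
    obtain ⟨g, hg⟩ := exists_equiv_of_pattern_eq hF hw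
    have := (FirstOrder.Language.StrongHomClass.realize_formula g φ (v := w)).2 h
    rwa [show (g ∘ w) = v from funext hg] at this

theorem realize_iff_of_pattern_eq (hF : FirstOrder.Language.IsFraisseLimit finiteClass.{u} F)
    {N : Type w} [Lang.Structure N] [N ⊨ Lang.completeTheory F] {ι : Type*} [Finite ι]
    (φ : Lang.Formula ι) {v w : ι → N} (h : pattern v = pattern w) :
    φ.Realize v ↔ φ.Realize w := by
  obtain ⟨S, hS⟩ := exists_patterns.{u, w} hF φ
  rw [hS N, hS N, realize_patternsFormula, realize_patternsFormula, h]

theorem hasQE (hF : FirstOrder.Language.IsFraisseLimit finiteClass.{u} F) :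
    HasQE (Lang.completeTheory F) := by
  intro n φ
  obtain ⟨S, hS⟩ := exists_patterns.{u, 0} hF φ
  refine ⟨patternsFormula S, isQF_patternsFormula S, fun M v xs => ?_⟩
  rw [FirstOrder.Language.BoundedFormula.realize_iff, Subsingleton.elim xs default]
  exact hS M v

variable {N : Type u} [Lang.Structure N] [N ⊨ Lang.completeTheory F]

theorem isZ_of_model (hF : FirstOrder.Language.IsFraisseLimit finiteClass.{u} F) :
    (rels N).IsZ := by
  refine Rels.IsZ.of_fin fun S => ?_
  obtain ⟨v, hv⟩ := exists_realize_of_realize (F := F) (patternFormula (pattern fun x : S => (x : N)))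
    (v := fun x : S => (x : N)) (realize_patternFormula.2 rfl)
  obtain ⟨h1, h2⟩ := pattern_eq_iff.1 (realize_patternFormula.1 hv)
  rw [← h1]
  exact (isZ_of_isFraisseLimit hF).comap fun i j hij => Subtype.ext ((h2 i j).1 hij)

/-- For finite `A` the extension property is a first-order statement: every tuple with the smaller
pattern extends to one with the larger pattern. -/
theorem hasExt_of_model (hF : FirstOrder.Language.IsFraisseLimit finiteClass.{u} F) :
    (rels N).HasExt ℵ₀ := by
  intro A hA r₀ h₀ σ hσ hc
  have : Finite A := Cardinal.lt_aleph0_iff_finite.1 hA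
  let φ : Lang.Formula A := patternFormula (r₀.comap some, fun i j => i = j)
  let ψ : Lang.Formula (A ⊕ Unit) := patternFormula
    (r₀.comap (Sum.elim some fun _ => none), fun i j => i = j)
  have key : ∀ v : A → F, (φ.imp (FirstOrder.Language.Formula.iExs Unit ψ)).Realize v := by
    intro v hv
    have hv' := realize_patternFormula.1 hv
    have h1 : (rels F).comap v = r₀.comap some := congrArg Prod.fst hv'
    have h2 : ∀ i j, v i = v j ↔ i = j := fun i j =>
      iff_of_eq (congrFun (congrFun (congrArg Prod.snd hv') i) j)
    obtain ⟨z, hz, hz'⟩ := hasExt_of_isFraisseLimit hF A hA r₀ h₀ v (fun i j h => (h2 i j).1 h) h1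
    refine FirstOrder.Language.Formula.realize_iExs.2 ⟨fun _ => z, ?_⟩
    refine realize_patternFormula.2 (Prod.ext ?_ ?_)
    · rw [← hz', Rels.comap_comap]
      refine congrArg (Rels.comap (rels F)) (funext fun x => ?_)
      rcases x with x | x <;> rfl
    · funext i j
      rcases i with i | i <;> rcases j with j | j
      · simpa [pattern] using h2 i j
      · simpa [pattern] using hz i
      · simpa [pattern] using (hz j).symm
      · simp [pattern]
  have h1 : φ.Realize σ := realize_patternFormula.2 (Prod.ext hc (by
    funext i j; exact propext hσ.eq_iff))
  obtain ⟨z, hz⟩ := FirstOrder.Language.Formula.realize_iExs.1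
    (realize_of_forall_realize (F := F) _ key σ h1)
  have hz' := realize_patternFormula.1 hz
  have h2 : (rels N).comap (Sum.elim σ z) = r₀.comap (Sum.elim some fun _ => none) :=
    congrArg Prod.fst hz'
  refine ⟨z (), fun a ha => ?_, ?_⟩
  · have := iff_of_eq (congrFun (congrFun (congrArg Prod.snd hz') (Sum.inl a)) (Sum.inr ()))
    exact absurd (this.1 ha) (by simp)
  · have := congrArg (fun r => Rels.comap r
      (fun x : Option A => x.elim (Sum.inr ()) Sum.inl)) h2
    simp only [Rels.comap_comap] at this
    convert this using 1
    · refine congrArg (Rels.comap (rels N)) (funext fun x => ?_)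
      cases x <;> rfl
    · refine (congrArg (Rels.comap r₀) (funext fun x => ?_ : id = _))
      cases x <;> rfl

/-- Countable models inherit the axioms and the extension property, hence are Fraïssé limits of the
same class, and these are unique. -/
theorem categorical (hF : FirstOrder.Language.IsFraisseLimit finiteClass.{u} F) :
    Cardinal.Categorical.{0, 0, u} ℵ₀ (Lang.completeTheory F) := by
  intro M N hM hN
  have : Countable M := Cardinal.mk_le_aleph0_iff.1 hM.le
  have : Countable N := Cardinal.mk_le_aleph0_iff.1 hN.le
  exact (isFraisseLimit_of_hasExt (isZ_of_model (N := M) hF) (hasExt_of_model hF)).nonempty_equiv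
    (isFraisseLimit_of_hasExt (isZ_of_model (N := N) hF) (hasExt_of_model hF))

end Limit

/-! ### Types, compactness and saturation -/

section General

variable {L : FirstOrder.Language.{u, v}} {N : Type w} [L.Structure N]

theorem realize_inst {A : Set N} {m n : ℕ} (φ : L.Formula (Fin m ⊕ Fin n)) (a : Fin n → A)
    (c : Fin m → N) : (inst φ a).Realize c ↔ φ.Realize (Sum.elim c (fun i => (a i : N))) := by
  unfold inst FirstOrder.Language.Formula.Realize
  rw [← FirstOrder.Language.BoundedFormula.realize_constantsVarsEquiv, Equiv.apply_symm_apply]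
  refine FirstOrder.Language.Formula.realize_relabel.trans ?_
  refine iff_of_eq (congrArg _ ?_)
  funext i
  rcases i with i | i <;> rfl

theorem realize_iff_realize_constantsVars {A : Set N} {m : ℕ} (φ : L[[A]].Formula (Fin m))
    (c : Fin m → N) : φ.Realize c ↔
      FirstOrder.Language.Formula.Realize (L := L) (α := A ⊕ Fin m)
        (FirstOrder.Language.BoundedFormula.constantsVarsEquiv φ)
        (Sum.elim (fun a : A => (a : N)) c) := by
  unfold FirstOrder.Language.Formula.Realize
  rw [← FirstOrder.Language.BoundedFormula.realize_constantsVarsEquiv]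
  exact Iff.rfl

theorem tp_eq_iff [Nonempty N] {A : Set N} {m : ℕ} {b c : Fin m → N} :
    tp L A b = tp L A c ↔ ∀ φ : L.Formula (A ⊕ Fin m),
      φ.Realize (Sum.elim (fun a : A => (a : N)) b) ↔
        φ.Realize (Sum.elim (fun a : A => (a : N)) c) := by
  constructor
  · intro h φ
    let ψ : L[[A]].Formula (Fin m) := FirstOrder.Language.BoundedFormula.constantsVarsEquiv.symm φ
    have hψ : ∀ d : Fin m → N, ψ.Realize d ↔ φ.Realize (Sum.elim (fun a : A => (a : N)) d) :=
      fun d => (realize_iff_realize_constantsVars ψ d).trans (by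
        simp only [ψ, Equiv.apply_symm_apply])
    rw [← hψ, ← hψ, ← FirstOrder.Language.Theory.CompleteType.formula_mem_typeOf
      (T := L[[A]].completeTheory N), ← FirstOrder.Language.Theory.CompleteType.formula_mem_typeOf
      (T := L[[A]].completeTheory N)]
    change _ ∈ tp L A b ↔ _ ∈ tp L A c
    rw [h]
  · intro h
    refine SetLike.ext fun φ => ?_
    refine FirstOrder.Language.Theory.CompleteType.mem_typeOf.trans (Iff.trans ?_
      FirstOrder.Language.Theory.CompleteType.mem_typeOf.symm)
    rw [realize_iff_realize_constantsVars, realize_iff_realize_constantsVars]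
    exact h _

theorem realize_iff_of_tp_eq [Nonempty N] {A : Set N} {m : ℕ} {b c : Fin m → N}
    (h : tp L A b = tp L A c) (φ : L.Formula (Fin m)) : φ.Realize b ↔ φ.Realize c := by
  have := tp_eq_iff.1 h (φ.relabel Sum.inr)
  rwa [FirstOrder.Language.Formula.realize_relabel, FirstOrder.Language.Formula.realize_relabel] at this

/-- A finitely satisfiable set of formulas over a small set is realized in a saturated model. -/
theorem IsSaturated.exists_realize [Nonempty N] {κ : Cardinal.{w}} (hs : IsSaturated L N κ)
    {A : Set N} (hA : #A < κ) {ι : Type*} (φ : ι → L[[A]].Formula (Fin 1))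
    (hfin : ∀ t : Finset ι, ∃ c : Fin 1 → N, ∀ i ∈ t, (φ i).Realize c) :
    ∃ c : Fin 1 → N, ∀ i, (φ i).Realize c := by
  classical
  let T := L[[A]].completeTheory N
  let S : L[[A]][[Fin 1]].Theory := Set.range fun i =>
    FirstOrder.Language.Formula.equivSentence (φ i)
  have hsat : ((L[[A]].lhomWithConstants (Fin 1)).onTheory T ∪ S).IsSatisfiable := by
    rw [FirstOrder.Language.Theory.isSatisfiable_iff_isFinitelySatisfiable]
    intro T₀ hT₀
    have hch : ∀ ψ : {ψ // ψ ∈ T₀ ∧ ψ ∈ S}, ∃ i,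
        FirstOrder.Language.Formula.equivSentence (φ i) = ψ.1 := fun ψ => ψ.2.2
    choose k hk using hch
    have : Finite {ψ // ψ ∈ T₀ ∧ ψ ∈ S} :=
      Finite.Set.subset (T₀ : Set _) (fun ψ h => h.1)
    have := Fintype.ofFinite {ψ // ψ ∈ T₀ ∧ ψ ∈ S}
    obtain ⟨c, hc⟩ := hfin (Finset.univ.image k)
    refine (T.typeOf c).isMaximal.1.mono ?_
    intro ψ hψ
    rcases hT₀ hψ with h | h
    · exact (T.typeOf c).subset h
    · have := hc (k ⟨ψ, hψ, h⟩) (Finset.mem_image_of_mem _ (Finset.mem_univ _))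
      rw [← FirstOrder.Language.Theory.CompleteType.formula_mem_typeOf (T := T), hk] at this
      exact this
  have hne : {p : T.CompleteType (Fin 1) | S ⊆ ↑p}.Nonempty := by
    rw [Set.nonempty_iff_ne_empty]
    intro h
    exact (FirstOrder.Language.Theory.CompleteType.setOfPred_subset_eq_empty_iff S).1 h hsat
  obtain ⟨p, hp⟩ := hne
  obtain ⟨c, hc⟩ := hs A hA p
  refine ⟨c, fun i => ?_⟩
  rw [← FirstOrder.Language.Theory.CompleteType.formula_mem_typeOf (T := T)]
  change _ ∈ tp L A c
  rw [hc]
  exact hp ⟨i, rfl⟩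

/-- A complete type over a structure is finitely satisfiable in it. -/
theorem exists_realize_of_mem_type {m : ℕ} [Nonempty N]
    (p : (L.completeTheory N).CompleteType (Fin m)) {ι : Type*} [Finite ι]
    (φ : ι → L.Formula (Fin m)) (h : ∀ i, FirstOrder.Language.Formula.equivSentence (φ i) ∈ p) :
    ∃ c : Fin m → N, ∀ i, (φ i).Realize c := by
  obtain ⟨M, v, hv⟩ := FirstOrder.Language.Theory.exists_modelType_is_realized_in _ p
  have h1 : (FirstOrder.Language.Formula.iInf φ).Realize v := by
    refine FirstOrder.Language.Formula.realize_iInf.2 fun i => ?_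
    rw [← FirstOrder.Language.Theory.CompleteType.formula_mem_typeOf (T := L.completeTheory N), hv]
    exact h i
  obtain ⟨c, hc⟩ := exists_realize_of_realize (F := N) _ h1
  exact ⟨c, FirstOrder.Language.Formula.realize_iInf.1 hc⟩

end General

/-! ### A saturated model: the ultrapower -/

section Ultrapower

variable {L : FirstOrder.Language.{0, 0}} {F : Type u} [L.Structure F] [Nonempty F]

/-- The ultrapower of `F` over a nonprincipal ultrafilter on `ℕ`. -/
abbrev Ultrapower (F : Type u) : Type u :=
  ((Filter.hyperfilter ℕ : Ultrafilter ℕ) : Filter ℕ).Product (fun _ => F)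

/-- The usual diagonal argument: at coordinate `k`, use the solution `c n` for the largest `n ≤ k`
that still satisfies the first `n` formulas at that coordinate. For each `i`, almost all coordinates
have passed stage `i + 1`. -/
theorem exists_realize_ultrapower {A : Type*} (a : A → Ultrapower F)
    (φ : ℕ → L.Formula (A ⊕ Fin 1))
    (h : ∀ n, ∃ c : Fin 1 → Ultrapower F, ∀ i < n, (φ i).Realize (Sum.elim a c)) :
    ∃ c : Fin 1 → Ultrapower F, ∀ i, (φ i).Realize (Sum.elim a c) := by
  classical
  choose c hc using h
  have hlift : ∀ x : Ultrapower F, ∃ f : ℕ → F, (f : Ultrapower F) = x := fun x =>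
    Quotient.exists_rep x
  choose lift hlift using hlift
  have los : ∀ (ψ : L.Formula (A ⊕ Fin 1)) (f : Fin 1 → ℕ → F),
      ψ.Realize (Sum.elim a (fun i => (f i : Ultrapower F))) ↔
        ∀ᶠ k in (Filter.hyperfilter ℕ : Filter ℕ),
          ψ.Realize (Sum.elim (fun x => lift (a x) k) (fun i => f i k)) := by
    intro ψ f
    have := FirstOrder.Language.Ultraproduct.realize_formula_cast (u := Filter.hyperfilter ℕ)
      (M := fun _ => F) ψ (Sum.elim (fun x => lift (a x)) f)
    have h1 : Sum.elim a (fun i => (f i : Ultrapower F)) =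
        fun i => ((Sum.elim (fun x => lift (a x)) f i : ℕ → F) : Ultrapower F) := by
      funext i
      rcases i with i | i
      · exact (hlift _).symm
      · rfl
    rw [h1]
    refine this.trans (Filter.eventually_congr (Filter.Eventually.of_forall fun k => ?_))
    refine iff_of_eq (congrArg _ (funext fun i => ?_))
    rcases i with i | i <;> rfl
  -- The clause `n ≤ k` keeps the search for a largest `n` bounded and still holds for almost all
  -- `k`, as the ultrafilter is nonprincipal.
  let P : ℕ → ℕ → Prop := fun n k => n ≤ k ∧ ∀ i < n,
    (φ i).Realize (Sum.elim (fun x => lift (a x) k) (fun j => lift (c n j) k))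
  have hP : ∀ n, ∀ᶠ k in (Filter.hyperfilter ℕ : Filter ℕ), P n k := by
    intro n
    refine Filter.Eventually.and ?_ ?_
    · exact Nat.hyperfilter_le_atTop (Filter.eventually_ge_atTop n)
    · have : ∀ i ∈ Finset.range n, ∀ᶠ k in (Filter.hyperfilter ℕ : Filter ℕ),
          (φ i).Realize (Sum.elim (fun x => lift (a x) k) (fun j => lift (c n j) k)) := by
        intro i hi
        rw [← los, show (fun j => ((lift (c n j) : ℕ → F) : Ultrapower F)) = c n from
          funext fun j => hlift _]
        exact hc n i (Finset.mem_range.1 hi)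
      filter_upwards [(Filter.eventually_all_finset _).2 this] with k hk i hi
      exact hk i (Finset.mem_range.2 hi)
  let d : ℕ → ℕ := fun k => Nat.findGreatest (fun n => P n k) k
  let g : Fin 1 → ℕ → F := fun j k => lift (c (d k) j) k
  refine ⟨fun j => (g j : Ultrapower F), fun i => (los _ _).2 ?_⟩
  filter_upwards [hP (i + 1)] with k hk
  have h1 : i + 1 ≤ d k := Nat.le_findGreatest hk.1 hk
  have h2 : P (d k) k := Nat.findGreatest_spec (P := fun n => P n k) hk.1 hk
  exact h2.2 i h1

/-- Over countably many parameters there are countably many formulas, so a complete type is a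
sequence choosing each formula or its negation. -/
theorem isSaturated_ultrapower [Countable L.Symbols] :
    IsSaturated L (Ultrapower F) (Order.succ ℵ₀) := by
  intro A hA p
  have hAc : Countable A := Cardinal.mk_le_aleph0_iff.1 (Order.lt_succ_iff.1 hA)
  have hcount : Countable (L[[A]].Formula (Fin 1)) := inferInstance
  obtain ⟨e, he⟩ := exists_surjective_nat (L[[A]].Formula (Fin 1))
  classical
  let ψ : ℕ → L[[A]].Formula (Fin 1) := fun n =>
    if FirstOrder.Language.Formula.equivSentence (e n) ∈ p then e n else (e n).not
  have hψ : ∀ n, FirstOrder.Language.Formula.equivSentence (ψ n) ∈ p := by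
    intro n
    by_cases h : FirstOrder.Language.Formula.equivSentence (e n) ∈ p
    · simpa only [ψ, if_pos h] using h
    · simp only [ψ, if_neg h, FirstOrder.Language.Formula.equivSentence_not]
      exact (FirstOrder.Language.Theory.CompleteType.not_mem_iff p _).2 h
  obtain ⟨c, hc⟩ := exists_realize_ultrapower (F := F) (fun a : A => (a : Ultrapower F))
    (fun n => FirstOrder.Language.BoundedFormula.constantsVarsEquiv (ψ n)) (by
      intro n
      obtain ⟨c, hc⟩ := exists_realize_of_mem_type p (fun i : Fin n => ψ i) (fun i => hψ i)
      exact ⟨c, fun i hi => (realize_iff_realize_constantsVars _ _).1 (hc ⟨i, hi⟩)⟩)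
  refine ⟨c, SetLike.ext fun φ => ?_⟩
  refine FirstOrder.Language.Theory.CompleteType.mem_typeOf.trans ?_
  obtain ⟨n, hn⟩ := he (FirstOrder.Language.Formula.equivSentence.symm φ)
  have h1 : (ψ n).Realize c := (realize_iff_realize_constantsVars _ _).2 (hc n)
  have h2 : FirstOrder.Language.Formula.equivSentence (e n) = φ := by simp [hn]
  by_cases h : φ ∈ p
  · simp only [ψ, h2, if_pos h] at h1
    rw [← hn]
    exact iff_of_true h1 h
  · simp only [ψ, h2, if_neg h, FirstOrder.Language.Formula.realize_not] at h1
    rw [← hn]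
    exact iff_of_false h1 h

theorem ultrapower_models : Ultrapower F ⊨ L.completeTheory F := by
  refine ⟨fun φ hφ => ?_⟩
  refine (FirstOrder.Language.Ultraproduct.sentence_realize (u := Filter.hyperfilter ℕ)
    (M := fun _ => F) φ).2 (Filter.Eventually.of_forall fun _ => ?_)
  exact FirstOrder.Language.mem_completeTheory.1 hφ

end Ultrapower

theorem countable_symbols : Countable Lang.Symbols := by
  have h1 : Countable (Σ l, Lang.Functions l) := inferInstance
  have h2 : Countable (Σ l, Lang.Relations l) := by
    let f : (Σ l, Lang.Relations l) → ℕ := fun R => match R with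
      | ⟨_, .point⟩ => 0
      | ⟨_, .mem⟩ => 1
      | ⟨_, .C⟩ => 2
      | ⟨_, .D⟩ => 3
    refine Function.Injective.countable (f := f) ?_
    rintro ⟨_, R⟩ ⟨_, R'⟩ h
    cases R <;> cases R' <;> simp_all [f]
  exact inferInstanceAs (Countable (_ ⊕ _))

/-! ### Extension problems and types in saturated models -/

theorem Rels.ext_of_comap_fin {A : Type*} {r r' : Rels (Option A)}
    (h : ∀ (n : ℕ) (f : Fin n → A), r.comap (Option.map f) = r'.comap (Option.map f)) : r = r' := by
  have hl : ∀ l : List (Option A), ∃ (n : ℕ) (f : Fin n → A), ∀ x ∈ l, ∃ x', Option.map f x' = x := by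
    intro l
    refine ⟨l.reduceOption.length, l.reduceOption.get, fun x hx => ?_⟩
    rcases x with _ | a
    · exact ⟨none, rfl⟩
    · obtain ⟨i, hi⟩ := List.mem_iff_get.1 (List.reduceOption_mem_iff.2 hx)
      exact ⟨some i, congrArg some hi⟩
  have key : ∀ a b c d : Option A, ∃ (n : ℕ) (f : Fin n → A) (a' b' c' d' : Option (Fin n)),
      Option.map f a' = a ∧ Option.map f b' = b ∧ Option.map f c' = c ∧ Option.map f d' = d := by
    intro a b c d
    obtain ⟨n, f, hf⟩ := hl [a, b, c, d]
    obtain ⟨a', ha⟩ := hf a (by simp)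
    obtain ⟨b', hb⟩ := hf b (by simp)
    obtain ⟨c', hc⟩ := hf c (by simp)
    obtain ⟨d', hd⟩ := hf d (by simp)
    exact ⟨n, f, a', b', c', d', ha, hb, hc, hd⟩
  refine Rels.ext (funext fun a => ?_) (funext fun a => funext fun b => ?_)
    (funext fun a => funext fun b => funext fun c => funext fun d => ?_)
    (funext fun a => funext fun b => funext fun c => funext fun d => ?_)
  · obtain ⟨n, f, a', -, -, -, rfl, -⟩ := key a a a a
    exact congrFun (congrArg Rels.pt (h n f)) a'
  · obtain ⟨n, f, a', b', -, -, rfl, rfl, -⟩ := key a b b b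
    exact congrFun (congrFun (congrArg Rels.E (h n f)) a') b'
  · obtain ⟨n, f, a', b', c', d', rfl, rfl, rfl, rfl⟩ := key a b c d
    exact congrFun (congrFun (congrFun (congrFun (congrArg Rels.C (h n f)) a') b') c') d'
  · obtain ⟨n, f, a', b', c', d', rfl, rfl, rfl, rfl⟩ := key a b c d
    exact congrFun (congrFun (congrFun (congrFun (congrArg Rels.D (h n f)) a') b') c') d'

/-- In saturated models, one-point extensions of small sets are realized. -/
theorem hasExt_of_isSaturated {N : Type u} [Lang.Structure N] [Nonempty N] {κ : Cardinal.{u}}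
    (hN : (rels N).HasExt ℵ₀) (hs : IsSaturated Lang N κ) :
    (rels N).HasExt κ := by
  classical
  intro A hA r₀ h₀ σ hσ hc
  let o : ∀ n, Fin 1 ⊕ Fin n → Option (Fin n) := fun n => Sum.elim (fun _ => none) some
  -- One pattern formula for each finite tuple of parameters. The equalities in the pattern keep the
  -- realization away from the range of `σ`.
  let φ : (Σ n, Fin n → A) → Lang[[Set.range σ]].Formula (Fin 1) := fun i =>
    inst (patternFormula ((r₀.comap (Option.map i.2)).comap (o i.1),
      fun x y => Option.map i.2 (o i.1 x) = Option.map i.2 (o i.1 y)))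
      (fun k => ⟨σ (i.2 k), Set.mem_range_self _⟩)
  have hφ : ∀ (i : Σ n, Fin n → A) (c : Fin 1 → N), (φ i).Realize c ↔
      pattern (Sum.elim c (fun k => σ (i.2 k))) = ((r₀.comap (Option.map i.2)).comap (o i.1),
        fun x y => Option.map i.2 (o i.1 x) = Option.map i.2 (o i.1 y)) := fun i c =>
    (realize_inst _ _ c).trans realize_patternFormula
  obtain ⟨c, hc'⟩ := hs.exists_realize (Cardinal.mk_range_le.trans_lt hA) φ (by
    intro t
    let A₀ : Finset A := t.biUnion fun i => Finset.univ.image i.2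
    have hA₀ : ∀ i ∈ t, ∀ k, i.2 k ∈ A₀ := fun i hi k =>
      Finset.mem_biUnion.2 ⟨i, hi, Finset.mem_image_of_mem _ (Finset.mem_univ _)⟩
    obtain ⟨z, hz, hz'⟩ := hN A₀ (Cardinal.lt_aleph0_of_finite _)
      (r₀.comap (Option.map (fun x : A₀ => (x : A))))
      (h₀.comap (Option.map_injective Subtype.val_injective)) (fun x => σ x)
      (hσ.comp Subtype.val_injective) (congrArg (fun r => Rels.comap r (fun x : A₀ => (x : A))) hc)
    refine ⟨fun _ => z, fun i hi => (hφ _ _).2 (Prod.ext ?_ ?_)⟩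
    · have := congrArg (fun r => Rels.comap r (fun x => Option.map
        (fun k => (⟨i.2 k, hA₀ i hi k⟩ : A₀)) (o i.1 x))) hz'
      simp only [Rels.comap_comap] at this
      convert this using 1
      · refine congrArg (Rels.comap (rels N)) (funext fun x => ?_)
        rcases x with x | x <;> rfl
      · refine congrArg (Rels.comap r₀) (funext fun x => ?_)
        rcases x with x | x <;> rfl
    · funext x y
      rcases x with x | x <;> rcases y with y | y
      · simp [pattern, o]
      · simpa [pattern, o] using fun h => hz ⟨i.2 y, hA₀ i hi y⟩ h.symm
      · simpa [pattern, o] using hz ⟨i.2 x, hA₀ i hi x⟩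
      · simp [pattern, o, hσ.eq_iff])
  have hp : ∀ n (f : Fin n → A), pattern (Sum.elim c (fun k => σ (f k))) =
      ((r₀.comap (Option.map f)).comap (o n), fun x y => Option.map f (o n x) = Option.map f (o n y)) :=
    fun n f => (hφ ⟨n, f⟩ c).1 (hc' ⟨n, f⟩)
  refine ⟨c 0, fun a ha => ?_, Rels.ext_of_comap_fin fun n f => ?_⟩
  · have := iff_of_eq (congrFun (congrFun (congrArg Prod.snd (hp 1 fun _ => a)) (Sum.inl 0))
      (Sum.inr 0))
    exact absurd (this.1 ha.symm) (by simp [o])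
  · have := congrArg (fun r => Rels.comap r
      (fun x : Option (Fin n) => x.elim (Sum.inl 0) Sum.inr)) (congrArg Prod.fst (hp n f))
    simp only [pattern, Rels.comap_comap] at this
    rw [Rels.comap_comap]
    convert this using 1
    · refine congrArg (Rels.comap (rels N)) (funext fun x => ?_)
      cases x <;> rfl
    · refine congrArg (Rels.comap r₀) (funext fun x => ?_)
      cases x <;> rfl

section Types

variable {F : Type u} [Lang.Structure F] [Countable F]
  {N : Type u} [Lang.Structure N] [N ⊨ Lang.completeTheory F]

/-- Infinite tuples are allowed, as is needed for types over infinite sets; only the finitely many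
free variables of `φ` matter. -/
theorem realize_iff_of_pattern_eq' (hF : FirstOrder.Language.IsFraisseLimit finiteClass.{u} F)
    {ι : Type*} (φ : Lang.Formula ι) {v w : ι → N} (h : pattern v = pattern w) :
    φ.Realize v ↔ φ.Realize w := by
  classical
  have key : ∀ v : ι → N, φ.Realize v ↔ FirstOrder.Language.Formula.Realize
      (φ.restrictFreeVar id : Lang.Formula φ.freeVarFinset) (fun i => v i) := fun v =>
    (FirstOrder.Language.BoundedFormula.realize_restrictFreeVar
      (v := fun i : φ.freeVarFinset => v i) (f := id) v (fun _ => rfl)).symm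
  rw [key v, key w]
  refine realize_iff_of_pattern_eq hF _ ?_
  obtain ⟨h1, h2⟩ := pattern_eq_iff.1 h
  refine pattern_eq_iff.2 ⟨?_, fun i j => h2 i j⟩
  exact congrArg (fun r => Rels.comap r (fun i : φ.freeVarFinset => (i : ι))) h1

theorem tp_eq_of_pattern_eq [Nonempty N] (hF : FirstOrder.Language.IsFraisseLimit finiteClass.{u} F)
    {A : Set N} {m : ℕ} {b c : Fin m → N}
    (h : pattern (Sum.elim (fun a : A => (a : N)) b) =
      pattern (Sum.elim (fun a : A => (a : N)) c)) : tp Lang A b = tp Lang A c :=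
  tp_eq_iff.2 fun φ => realize_iff_of_pattern_eq' hF φ h

end Types

/-! ### Arcs and clones -/

section Abstract

/-- Seen from `p` the points come in the order `a, b, c, d`, so the half-open arcs `[a, b)` and `[c,
d)` do not meet. -/
theorem IsCirc.disjoint_arcs {X : Type*} {P : X → Prop} {T : X → X → X → Prop} (h : IsCirc P T)
    {p a b c d x : X} (h1 : T p a b) (h2 : T p b c) (h3 : T p c d) (hx : T a x b ∨ x = a) :
    ¬ (T c x d ∨ x = c) := by
  have hc := h.cyc
  have ha := h.asymm
  have ht := h.trans
  have h4 : T a b c := by grind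
  have h5 : T b c d := by grind
  rcases hx with hx | rfl
  · have h6 : T x b c := by grind
    grind
  · grind

theorem IsCirc.arcs_cover {X : Type*} {P : X → Prop} {T : X → X → X → Prop} (h : IsCirc P T)
    {a b x : X} (ha : P a) (hb : P b) (hx : P x) (hab : a ≠ b) :
    (T a x b ∨ x = a) ∨ (T b x a ∨ x = b) := by
  by_cases h1 : x = a
  · exact Or.inl (Or.inr h1)
  by_cases h2 : x = b
  · exact Or.inr (Or.inr h2)
  rcases h.total a x b ha hx hb (Ne.symm h1) h2 hab with h3 | h3
  · exact Or.inl (Or.inl h3)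
  · exact Or.inr (Or.inl h3)

namespace Rels

variable {N : Type u} {r : Rels N} {κ : Cardinal.{u}}

/-- Clones of the point `p` over `M`, inserted one after the other immediately after `p` (or
immediately before `p`, in the circles of the sets in `W`). -/
theorem HasExt.exists_clones (h : r.HasExt κ) (hr : r.IsZ) (hκ : ℵ₀ ≤ κ) {M : Set N} (hM : #M < κ)
    {p : N} (hp : r.pt p) (hpM : p ∉ M) (W : N → Prop) :
    ∃ y : ℕ → N, (∀ i, (y i ∉ M ∧ y i ≠ p ∧ r.pt (y i)) ∧ (∀ s ∈ M, r.E (y i) s ↔ r.E p s) ∧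
      (∀ s ∈ M, ∀ a ∈ M, ∀ b ∈ M, r.C (y i) a b s ↔ r.C p a b s) ∧
      (∀ a ∈ M, ∀ b ∈ M, ∀ c ∈ M, r.D a b c (y i) ↔ r.D a b c p) ∧
      (∀ s ∈ M, ¬ W s → r.E p s → ∀ a ∈ M, r.E a s → r.C p (y i) a s)) ∧
      ∀ i j, i < j → y i ≠ y j ∧ ∀ s ∈ M, r.E p s →
        (¬ W s → r.C p (y j) (y i) s) ∧ (W s → r.C p (y i) (y j) s) := by
  classical
  refine exists_seq_of_forall_finset_exists
    (fun z => (z ∉ M ∧ z ≠ p ∧ r.pt z) ∧ (∀ s ∈ M, r.E z s ↔ r.E p s) ∧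
      (∀ s ∈ M, ∀ a ∈ M, ∀ b ∈ M, r.C z a b s ↔ r.C p a b s) ∧
      (∀ a ∈ M, ∀ b ∈ M, ∀ c ∈ M, r.D a b c z ↔ r.D a b c p) ∧
      (∀ s ∈ M, ¬ W s → r.E p s → ∀ a ∈ M, r.E a s → r.C p z a s))
    (fun x y => x ≠ y ∧ ∀ s ∈ M, r.E p s →
        (¬ W s → r.C p y x s) ∧ (W s → r.C p x y s)) ?_
  intro S hS
  -- The earlier clones are parameters too, so that the new one falls between them and `p`.
  let A : Set N := M ∪ (insert p S : Finset N)
  have hA : #A < κ := (Cardinal.mk_union_le _ _).trans_lt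
    (Cardinal.add_lt_of_lt hκ hM ((Cardinal.lt_aleph0_of_finite _).trans_le hκ))
  have hMA : ∀ {x}, x ∈ M → x ∈ A := fun hx => Or.inl hx
  have hpA : p ∈ A := Or.inr (by simp)
  have hSA : ∀ {x}, x ∈ S → x ∈ A := fun hx => Or.inr (by simp [hx])
  -- Inserting at the cut before (after) `p` places the new point immediately before (after) `p`. No
  -- element of `M` separates the two, whence the same relations to `M` as `p`.
  let L : N → N → N → Prop := fun s => if W s then cutBefore (fun t => r.E t s)
    (fun a b c => r.C a b c s) p else cutAfter (fun t => r.E t s) (fun a b c => r.C a b c s) p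
  have hcirc : ∀ s, r.E p s → IsCirc (fun t => r.E t s) (fun a b c => r.C a b c s) := fun s hs =>
    hr.C_circ s (hr.sorts _ _ hs).2
  have hneM : ∀ {x}, x ∈ M → x ≠ p := fun hx h => hpM (h ▸ hx)
  obtain ⟨z, hzA, hz, hE, hC, hD⟩ := h.exists_pt hr A hA (fun s => r.E p s) L
    (fun a b c => r.D a b c p) (fun s hs => (hr.sorts _ _ hs).2) (by
      intro s hs
      by_cases hW : W s
      · simp only [L, if_pos hW]
        exact (hcirc s hs).isCut_cutBefore hs
      · simp only [L, if_neg hW]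
        exact (hcirc s hs).isCut_cutAfter hs) (hr.D_circ p hp)
  have hafter : ∀ s ∈ M, ¬ W s → r.E p s → ∀ a ∈ A, a ≠ p → r.E a s → r.C p z a s := by
    intro s hs hW hps a ha hap hEa
    refine (hcirc s hps).cyc _ _ _ ((hcirc s hps).cyc _ _ _ ?_)
    refine (hC s (hMA hs) a ha p hpA).2 ⟨hps, ?_⟩
    simp only [L, if_neg hW]
    exact Or.inl ⟨rfl, hap, hEa, hps⟩
  have hbefore : ∀ s ∈ M, W s → r.E p s → ∀ a ∈ A, a ≠ p → r.E a s → r.C p a z s := by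
    intro s hs hW hps a ha hap hEa
    refine (hcirc s hps).cyc _ _ _ ?_
    refine (hC s (hMA hs) p hpA a ha).2 ⟨hps, ?_⟩
    simp only [L, if_pos hW]
    exact Or.inl ⟨rfl, hap, hps, hEa⟩
  refine ⟨z, ⟨⟨fun h => hzA (hMA h), fun h => hzA (h ▸ hpA), hz⟩, fun s hs => hE s (hMA hs), ?_,
    fun a ha b hb c hc => hD a (hMA ha) b (hMA hb) c (hMA hc),
    fun s hs hW hps a ha hEa => hafter s hs hW hps a (hMA ha) (hneM ha) hEa⟩, ?_⟩
  · intro s hs a ha b hb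
    rw [hC s (hMA hs) a (hMA ha) b (hMA hb)]
    constructor
    · rintro ⟨hps, hL⟩
      by_cases hW : W s
      · simp only [L, if_pos hW, cutBefore] at hL
        exact hL.resolve_left fun h => hneM ha h.1
      · simp only [L, if_neg hW, cutAfter] at hL
        exact hL.resolve_left fun h => hneM hb h.1
    · intro h
      refine ⟨(hr.C_dom' h).2.1, ?_⟩
      by_cases hW : W s
      · simp only [L, if_pos hW]
        exact Or.inr h
      · simp only [L, if_neg hW]
        exact Or.inr h
  · intro x hx
    refine ⟨fun hxz => hzA (hxz ▸ hSA hx), fun s hs hps => ⟨fun hW => ?_, fun hW => ?_⟩⟩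
    · exact hafter s hs hW hps x (hSA hx) (hS x hx).1.2.1 (((hS x hx).2.1 s hs).2 hps)
    · exact hbefore s hs hW hps x (hSA hx) (hS x hx).1.2.1 (((hS x hx).2.1 s hs).2 hps)

/-- A pair of clones of `p` over `M`, the first preceding the second and both next to `p` in all
the circles of `M` with further elements. -/
structure ClonePair (r : Rels N) (M : Set N) (p u v : N) : Prop where
  ne : u ≠ v
  notMem : u ∉ M ∧ v ∉ M
  pt : r.pt u ∧ r.pt v
  E : ∀ s ∈ M, (r.E u s ↔ r.E p s) ∧ (r.E v s ↔ r.E p s)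
  C : ∀ s ∈ M, ∀ a ∈ M, ∀ b ∈ M, (r.C u a b s ↔ r.C p a b s) ∧ (r.C v a b s ↔ r.C p a b s)
  D : ∀ a ∈ M, ∀ b ∈ M, ∀ c ∈ M, (r.D a b c u ↔ r.D a b c p) ∧ (r.D a b c v ↔ r.D a b c p)
  -- Vacuous for a set whose circle contains nothing of `M`: there the order of `u` and `v` around
  -- `p` remains free.
  next : ∀ s ∈ M, r.E p s → ∀ a ∈ M, r.E a s → r.C u v a s

/-- The family enumerating `M` and the pair. -/
def pairFamily (M : Set N) (u v : N) : M ⊕ Bool → N := Sum.elim (fun a => (a : N)) fun b => cond b u v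

/-- A triple with one entry from the pair is decided by `p`, one with both entries by `next`, and a
repeated entry is impossible. The converse follows by exchanging the pairs. -/
theorem ClonePair.C_imp (hr : r.IsZ) {M : Set N} {p u v u' v' : N} (h : ClonePair r M p u v)
    (h' : ClonePair r M p u' v') (i j k l : M ⊕ Bool)
    (hC : r.C (pairFamily M u v i) (pairFamily M u v j) (pairFamily M u v k) (pairFamily M u v l)) :
    r.C (pairFamily M u' v' i) (pairFamily M u' v' j) (pairFamily M u' v' k)
      (pairFamily M u' v' l) := by
  rcases l with s | l
  · have hs := hr.C_dom _ _ _ _ hC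
    have hci := hr.C_circ _ hs
    have hd := hci.dom
    have hcyc := hci.cyc
    have has := hci.asymm
    have hne := fun a b c => hci.ne (a := a) (b := b) (c := c)
    have e := h.E s s.2
    have e' := h'.E s s.2
    have c := h.C s s.2
    have c' := h'.C s s.2
    have n := h.next s s.2
    have n' := h'.next s s.2
    have hn := h.ne
    simp only [pairFamily, Sum.elim_inl] at *
    rcases i with a | a <;> rcases j with b | b <;> rcases k with d | d
    all_goals simp only [Sum.elim_inl, Sum.elim_inr] at *
    · exact hC
    · cases d <;> simp only [cond] at * <;> grind
    · cases b <;> simp only [cond] at * <;> grind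
    · cases b <;> cases d <;> simp only [cond] at * <;> grind
    · cases a <;> simp only [cond] at * <;> grind
    · cases a <;> cases d <;> simp only [cond] at * <;> grind
    · cases a <;> cases b <;> simp only [cond] at * <;> grind
    · cases a <;> cases b <;> cases d <;> simp only [cond] at * <;> grind
  · have hs := hr.C_dom _ _ _ _ hC
    have := h.pt
    cases l <;> simp_all [pairFamily]

theorem ClonePair.D_imp (hr : r.IsZ) {M : Set N} {p u v u' v' : N} (h : ClonePair r M p u v)
    (h' : ClonePair r M p u' v') (i j k l : M ⊕ Bool)
    (hD : r.D (pairFamily M u v i) (pairFamily M u v j) (pairFamily M u v k) (pairFamily M u v l)) :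
    r.D (pairFamily M u' v' i) (pairFamily M u' v' j) (pairFamily M u' v' k)
      (pairFamily M u' v' l) := by
  obtain ⟨-, ⟨hi, -⟩, ⟨hj, -⟩, hk, -⟩ := hr.D_dom' hD
  have hpt := h.pt
  rcases i with a | a
  swap
  · cases a <;> simp_all [pairFamily]
  rcases j with b | b
  swap
  · cases b <;> simp_all [pairFamily]
  rcases k with c | c
  swap
  · cases c <;> simp_all [pairFamily]
  rcases l with t | t
  · exact hD
  · have hd := h.D a a.2 b b.2 c c.2
    have hd' := h'.D a a.2 b b.2 c c.2
    cases t
    · exact hd'.2.2 (hd.2.1 hD)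
    · exact hd'.1.2 (hd.1.1 hD)

theorem ClonePair.comap_eq (hr : r.IsZ) {M : Set N} {p u v u' v' : N} (h : ClonePair r M p u v)
    (h' : ClonePair r M p u' v') :
    r.comap (pairFamily M u v) = r.comap (pairFamily M u' v') ∧
      ∀ i j, pairFamily M u v i = pairFamily M u v j ↔ pairFamily M u' v' i = pairFamily M u' v' j := by
  have hinj : ∀ {u v}, ClonePair r M p u v → Function.Injective (pairFamily M u v) := by
    intro u v h i j hij
    have h1 := h.ne
    have h2 := h.notMem
    rcases i with i | i <;> rcases j with j | j
    · exact congrArg Sum.inl (Subtype.ext hij)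
    · exfalso
      have hi := i.2
      cases j <;> simp only [pairFamily, Sum.elim_inl, Sum.elim_inr, cond] at hij <;> grind
    · exfalso
      have hj := j.2
      cases i <;> simp only [pairFamily, Sum.elim_inl, Sum.elim_inr, cond] at hij <;> grind
    · cases i <;> cases j <;> simp_all [pairFamily, eq_comm]
  have hpt : ∀ {u v}, ClonePair r M p u v → ∀ b : Bool, r.pt (pairFamily M u v (Sum.inr b)) := by
    intro u v h b
    cases b
    · exact h.pt.2
    · exact h.pt.1
  have hE : ∀ {u v}, ClonePair r M p u v → ∀ (b : Bool) (s : M),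
      r.E (pairFamily M u v (Sum.inr b)) s ↔ r.E p s := by
    intro u v h b s
    cases b
    · exact (h.E s s.2).2
    · exact (h.E s s.2).1
  refine ⟨Rels.ext (funext fun a => propext ?_) (funext fun a => funext fun b => propext ?_)
    (funext fun a => funext fun b => funext fun c => funext fun d => propext ?_)
    (funext fun a => funext fun b => funext fun c => funext fun d => propext ?_), fun i j => by
      rw [(hinj h).eq_iff, (hinj h').eq_iff]⟩
  · rcases a with a | a
    · exact Iff.rfl
    · exact iff_of_true (hpt h a) (hpt h' a)
  · rcases b with b | b
    · rcases a with a | a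
      · exact Iff.rfl
      · exact (hE h a b).trans (hE h' a b).symm
    · exact iff_of_false (fun h1 => (hr.sorts _ _ h1).2 (hpt h b))
        (fun h1 => (hr.sorts _ _ h1).2 (hpt h' b))
  · exact ⟨h.C_imp hr h' a b c d, h'.C_imp hr h a b c d⟩
  · exact ⟨h.D_imp hr h' a b c d, h'.D_imp hr h a b c d⟩

/-- Around a set `s₀` whose circle misses `M` there are pairs of clones over `M` and `s₀` which
cut out pairwise disjoint arcs, in either direction. -/
theorem HasExt.exists_clonePairs (h : r.HasExt κ) (hr : r.IsZ) (hκ : ℵ₀ ≤ κ) {M : Set N}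
    (hM : #M < κ) {s₀ : N} (hs₀ : ¬ r.pt s₀) (hM₀ : ∀ t ∈ M, ¬ r.E t s₀) :
    ∃ (p : N) (u v u' v' : ℕ → N), r.E p s₀ ∧
      (∀ i, ClonePair r (insert s₀ M) p (u i) (v i)) ∧
      (∀ i, ClonePair r (insert s₀ M) p (u' i) (v' i)) ∧
      (∀ i j, i < j → r.C p (u j) (v j) s₀ ∧ r.C p (v j) (u i) s₀ ∧ r.C p (u i) (v i) s₀) ∧
      (∀ i j, i < j → r.C p (v' i) (u' i) s₀ ∧ r.C p (u' i) (v' j) s₀ ∧ r.C p (v' j) (u' j) s₀) := by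
  obtain ⟨p, hps, hp, hpE⟩ := h.exists_pt_mem hr {s₀} (by
    rw [Cardinal.mk_singleton]; exact one_lt_aleph0.trans_le hκ)
  have hp₀ : r.E p s₀ := hpE s₀ rfl hs₀
  have hpM : p ∉ insert s₀ M := by
    rintro (h' | h')
    · exact hps h'
    · exact hM₀ _ h' hp₀
  have hM' : #(insert s₀ M : Set N) < κ := (Cardinal.mk_insert_le).trans_lt
    (Cardinal.add_lt_of_lt hκ hM (one_lt_aleph0.trans_le hκ))
  have hmiss : ∀ a ∈ insert s₀ M, ¬ r.E a s₀ := by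
    rintro a (rfl | ha) hE
    · exact hs₀ (hr.sorts _ _ hE).1
    · exact hM₀ a ha hE
  -- Later clones are closer to `p`, so after `p` the odd index `2 * i + 1` precedes `2 * i`.
  -- Circles that contain elements of `M` differ from that of `s₀`, so the choice of `W` does not
  -- affect `next`.
  have key : ∀ (W : N → Prop), (∀ s, W s → s = s₀) → ∀ y : ℕ → N,
      ((∀ i, (y i ∉ insert s₀ M ∧ y i ≠ p ∧ r.pt (y i)) ∧
        (∀ s ∈ insert s₀ M, r.E (y i) s ↔ r.E p s) ∧
        (∀ s ∈ insert s₀ M, ∀ a ∈ insert s₀ M, ∀ b ∈ insert s₀ M, r.C (y i) a b s ↔ r.C p a b s) ∧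
        (∀ a ∈ insert s₀ M, ∀ b ∈ insert s₀ M, ∀ c ∈ insert s₀ M, r.D a b c (y i) ↔ r.D a b c p) ∧
        (∀ s ∈ insert s₀ M, ¬ W s → r.E p s → ∀ a ∈ insert s₀ M, r.E a s → r.C p (y i) a s)) ∧
        ∀ i j, i < j → y i ≠ y j ∧ ∀ s ∈ insert s₀ M, r.E p s →
          (¬ W s → r.C p (y j) (y i) s) ∧ (W s → r.C p (y i) (y j) s)) →
      ∀ i, ClonePair r (insert s₀ M) p (y (2 * i + 1)) (y (2 * i)) := by
    rintro W hW y ⟨h1, h2⟩ i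
    have h3 := h2 (2 * i) (2 * i + 1) (by omega)
    refine ⟨h3.1.symm, ⟨(h1 _).1.1, (h1 _).1.1⟩, ⟨(h1 _).1.2.2, (h1 _).1.2.2⟩,
      fun s hs => ⟨(h1 _).2.1 s hs, (h1 _).2.1 s hs⟩,
      fun s hs a ha b hb => ⟨(h1 _).2.2.1 s hs a ha b hb, (h1 _).2.2.1 s hs a ha b hb⟩,
      fun a ha b hb c hc => ⟨(h1 _).2.2.2.1 a ha b hb c hc, (h1 _).2.2.2.1 a ha b hb c hc⟩, ?_⟩
    intro s hs hps a ha hEa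
    have hWs : ¬ W s := fun hw => hmiss a ha (hW s hw ▸ hEa)
    have h4 := (h3.2 s hs hps).1 hWs
    have h5 := (h1 (2 * i)).2.2.2.2 s hs hWs hps a ha hEa
    have hci := hr.C_circ s (hr.sorts _ _ hps).2
    exact hci.cyc _ _ _ (hci.trans _ _ _ _ (hci.cyc _ _ _ (hci.cyc _ _ _ h5)) h4)
  -- Both sequences pile up behind `p` in the circles meeting `M`. Around `s₀`, however, `z` piles
  -- up in front of `p`, which reverses its order there and makes the opposite arcs disjoint.
  obtain ⟨y, hy⟩ := h.exists_clones hr hκ hM' hp hpM (fun _ => False)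
  obtain ⟨z, hz⟩ := h.exists_clones hr hκ hM' hp hpM (fun s => s = s₀)
  have hys : ∀ i j, i < j → r.C p (y j) (y i) s₀ := fun i j hij =>
    ((hy.2 i j hij).2 s₀ (Set.mem_insert _ _) hp₀).1 id
  have hzs : ∀ i j, i < j → r.C p (z i) (z j) s₀ := fun i j hij =>
    ((hz.2 i j hij).2 s₀ (Set.mem_insert _ _) hp₀).2 rfl
  exact ⟨p, fun i => y (2 * i + 1), fun i => y (2 * i), fun i => z (2 * i + 1), fun i => z (2 * i),
    hp₀, key _ (fun _ h => h.elim) y hy, key _ (fun _ h => h) z hz,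
    fun i j hij => ⟨hys _ _ (by omega), hys _ _ (by omega), hys _ _ (by omega)⟩,
    fun i j hij => ⟨hzs _ _ (by omega), hzs _ _ (by omega), hzs _ _ (by omega)⟩⟩

end Rels

end Abstract

/-! ### Dividing arcs and forking -/

section Forking

theorem pattern_comap {X Y : Type*} [Lang.Structure X] [Lang.Structure Y] {ι ι' : Type*}
    {v : ι → X} {w : ι → Y} (h : pattern v = pattern w) (f : ι' → ι) :
    pattern (fun i => v (f i)) = pattern (fun i => w (f i)) := by
  obtain ⟨h1, h2⟩ := pattern_eq_iff.1 h
  exact pattern_eq_iff.2 ⟨congrArg (fun r => Rels.comap r f) h1, fun i j => h2 _ _⟩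

/-- The formula `x ∈ [y_i, y_j)`, in the circle of `y₂`. -/
def arcFormula (R : Lang.Relations 4) (i j : Fin 3) : Lang.Formula (Fin 1 ⊕ Fin 3) :=
  relFormula R ![Sum.inr i, Sum.inl 0, Sum.inr j, Sum.inr 2] ⊔
    FirstOrder.Language.Term.equal (FirstOrder.Language.Term.var (Sum.inl 0))
      (FirstOrder.Language.Term.var (Sum.inr i))

theorem realize_arcFormula {X : Type*} [Lang.Structure X] {r : Rels X} {R : Lang.Relations 4}
    (hR : ∀ x : Fin 4 → X, FirstOrder.Language.Structure.RelMap R x ↔ r.C (x 0) (x 1) (x 2) (x 3))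
    {i j : Fin 3} {x : Fin 1 → X} {b : Fin 3 → X} :
    (arcFormula R i j).Realize (Sum.elim x b) ↔ r.C (b i) (x 0) (b j) (b 2) ∨ x 0 = b i := by
  rw [arcFormula, FirstOrder.Language.Formula.realize_sup, realize_relFormula, hR,
    FirstOrder.Language.Formula.realize_equal]
  exact Iff.rfl

variable {F : Type u} [Lang.Structure F] [Countable F]
  {N : Type u} [Lang.Structure N] [Nonempty N] [N ⊨ Lang.completeTheory F]

/-- Patterns determine types, and dualizing twice recovers the relations, so agreement in the dual
structure suffices as well. -/
theorem tp_clonePair_eq (hF : FirstOrder.Language.IsFraisseLimit finiteClass.{u} F)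
    {r : Rels N} (hr : r.IsZ) (hrels : r = rels N ∨ r = (rels N).dual) {M : Set N}
    {s₀ p u v u' v' : N} (h : r.ClonePair (insert s₀ M) p u v)
    (h' : r.ClonePair (insert s₀ M) p u' v') :
    tp Lang M ![u, v, s₀] = tp Lang M ![u', v', s₀] := by
  obtain ⟨h1, h2⟩ := h.comap_eq hr h'
  have h3 : pattern (Rels.pairFamily (insert s₀ M) u v) =
      pattern (Rels.pairFamily (insert s₀ M) u' v') := by
    refine pattern_eq_iff.2 ⟨?_, h2⟩
    rcases hrels with rfl | rfl
    · exact h1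
    · have hZ : (rels N).IsZ := isZ_of_model hF
      rw [← hZ.dual_dual, ← Rels.dual_comap, h1, Rels.dual_comap]
  let f : M ⊕ Fin 3 → (insert s₀ M : Set N) ⊕ Bool := Sum.elim
    (fun a => Sum.inl ⟨a, Set.mem_insert_of_mem _ a.2⟩)
    ![Sum.inr true, Sum.inr false, Sum.inl ⟨s₀, Set.mem_insert _ _⟩]
  have h4 : ∀ u v : N, (fun i => Rels.pairFamily (insert s₀ M) u v (f i)) =
      Sum.elim (fun a : M => (a : N)) ![u, v, s₀] := by
    intro u v
    funext i
    rcases i with i | i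
    · rfl
    · fin_cases i <;> rfl
  refine tp_eq_of_pattern_eq hF ?_
  rw [← h4, ← h4]
  exact pattern_comap h3 f

theorem divides_arcFormula {r : Rels N} {R : Lang.Relations 4}
    (hR : ∀ x : Fin 4 → N, FirstOrder.Language.Structure.RelMap R x ↔ r.C (x 0) (x 1) (x 2) (x 3))
    {M : Set N} {s₀ : N} {i j : Fin 3} {a : Fin 3 → N} {b : ℕ → Fin 3 → N}
    (hb : ∀ n, tp Lang M (b n) = tp Lang M a) (hb₂ : ∀ n, b n 2 = s₀)
    (hdisj : ∀ n m, n < m → ∀ x, (r.C (b n i) x (b n j) s₀ ∨ x = b n i) →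
      ¬ (r.C (b m i) x (b m j) s₀ ∨ x = b m i)) :
    Divides M (arcFormula R i j) a := by
  refine ⟨1, b, hb, fun I hI => ?_⟩
  obtain ⟨n, m, hnm, rfl⟩ := Finset.card_eq_two.1 hI
  rintro ⟨x, hx⟩
  have h1 := (realize_arcFormula hR).1 (hx n (by simp))
  have h2 := (realize_arcFormula hR).1 (hx m (by simp))
  rw [hb₂] at h1 h2
  rcases lt_or_gt_of_ne hnm with h | h
  · exact hdisj _ _ h _ h1 h2
  · exact hdisj _ _ h _ h2 h1

/-- Membership in a set without elements in the base forks. -/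
theorem forks_of_realize_imp (hF : FirstOrder.Language.IsFraisseLimit finiteClass.{u} F)
    {κ : Cardinal.{u}} {r : Rels N} (hr : r.IsZ) (hrels : r = rels N ∨ r = (rels N).dual)
    (hext : r.HasExt κ) (hκ : ℵ₀ ≤ κ) {R : Lang.Relations 4}
    (hR : ∀ x : Fin 4 → N, FirstOrder.Language.Structure.RelMap R x ↔ r.C (x 0) (x 1) (x 2) (x 3))
    {M : Set N} (hM : #M < κ) {s₀ : N} (hs₀ : ¬ r.pt s₀) (hM₀ : ∀ t ∈ M, ¬ r.E t s₀)
    {φ : Lang.Formula (Fin 1 ⊕ Fin 1)}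
    (hφ : ∀ x : Fin 1 → N, φ.Realize (Sum.elim x ![s₀]) → r.E (x 0) s₀) :
    Forks M φ ![s₀] := by
  obtain ⟨p, u, v, u', v', hp, hc, hc', ho, ho'⟩ := hext.exists_clonePairs hr hκ hM hs₀ hM₀
  have hci := hr.C_circ s₀ hs₀
  -- The circle of `s₀` is the union of `[u 0, v 0)` and `[v 0, u 0)`. The first arc divides along
  -- the pairs `u, v`, the second along the conjugate pairs `u', v'`.
  refine ⟨2, fun _ => 3, ![arcFormula R 0 1, arcFormula R 1 0], fun _ => ![u 0, v 0, s₀], ?_, ?_⟩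
  · intro x hx
    have hE := (hc 0).E s₀ (Set.mem_insert _ _)
    rcases hci.arcs_cover (hE.1.2 hp) (hE.2.2 hp) (hφ x hx) (hc 0).ne with h | h
    · exact ⟨0, (realize_arcFormula hR).2 h⟩
    · exact ⟨1, (realize_arcFormula hR).2 h⟩
  · intro i
    fin_cases i
    · refine divides_arcFormula hR (b := fun n => ![u n, v n, s₀])
        (fun n => tp_clonePair_eq hF hr hrels (hc n) (hc 0)) (fun n => rfl) ?_
      intro n m hnm x hx hx'
      obtain ⟨h1, h2, h3⟩ := ho n m hnm
      exact hci.disjoint_arcs h1 h2 h3 hx' hx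
    · refine divides_arcFormula hR (b := fun n => ![u' n, v' n, s₀])
        (fun n => tp_clonePair_eq hF hr hrels (hc' n) (hc 0)) (fun n => rfl) ?_
      intro n m hnm x hx hx'
      obtain ⟨h1, h2, h3⟩ := ho' n m hnm
      exact hci.disjoint_arcs h1 h2 h3 hx hx'

theorem Divides.quasiDivides {L : FirstOrder.Language.{v, w}} {N : Type u} [L.Structure N]
    [Nonempty N] {A : Set N} {m n : ℕ} {φ : L.Formula (Fin m ⊕ Fin n)} {a : Fin n → N}
    (h : Divides A φ a) : QuasiDivides A φ a := by
  obtain ⟨k, b, hb, hI⟩ := h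
  refine ⟨k + 1, fun i => b i, fun i => hb i, ?_⟩
  rintro ⟨x, hx⟩
  exact hI (Finset.range (k + 1)) (by simp)
    ⟨x, fun i hi => hx ⟨i, Finset.mem_range.1 hi⟩⟩

end Forking

theorem Rels.HasExt.infinite {N : Type u} {r : Rels N} (h : r.HasExt ℵ₀) (hr : r.IsZ) :
    Infinite N := by
  by_contra hn
  rw [not_infinite_iff_finite] at hn
  obtain ⟨z, hz, -⟩ := h.exists_pt_mem hr Set.univ (Cardinal.lt_aleph0_of_finite _)
  exact hz trivial

theorem hasFormula_not {L : FirstOrder.Language.{u, v}} {N : Type w} [L.Structure N] {A : Set N}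
    {m n : ℕ} {p : TypeOver L A m} {φ : L.Formula (Fin m ⊕ Fin n)} {a : Fin n → A}
    (h : ¬ HasFormula p φ a) : HasFormula p φ.not a := by
  have := (FirstOrder.Language.Theory.CompleteType.not_mem_iff p _).2 h
  rw [← FirstOrder.Language.Formula.equivSentence_not] at this
  exact this

/-- Restrictions of global types to small sets are realized in saturated models. -/
theorem IsSaturated.exists_realizesRestriction {L : FirstOrder.Language.{u, v}} {N : Type w}
    [L.Structure N] [Nonempty N] {κ : Cardinal.{w}} (hs : IsSaturated L N κ)
    (q : GlobalType L N 1) {C : Set N} (hC : #C < κ) :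
    ∃ c : Fin 1 → N, q.RealizesRestriction C c := by
  let ι := Σ n : ℕ, {x : L.Formula (Fin 1 ⊕ Fin n) × (Fin n → C) // q.Has x.1 (fun i => x.2 i)}
  obtain ⟨c, hc⟩ := hs.exists_realize hC (fun i : ι => inst i.2.1.1 i.2.1.2) (by
    intro t
    obtain ⟨c, hc⟩ := exists_realize_of_mem_type q (fun i : t => inst i.1.2.1.1
      (fun k => (⟨i.1.2.1.2 k, Set.mem_univ _⟩ : (Set.univ : Set N)))) (fun i => i.1.2.2)
    refine ⟨c, fun i hi => (realize_inst _ _ _).2 ?_⟩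
    have h := hc ⟨i, hi⟩
    rw [realize_inst] at h
    exact h)
  refine ⟨c, fun n φ a ha h => ?_⟩
  exact (realize_inst _ _ _).1 (hc ⟨n, (φ, fun i => ⟨a i, ha i⟩), h⟩)

theorem aleph0_le_of_elementarySubstructure {F : Type u} [Lang.Structure F] [Countable F]
    {N : Type u} [Lang.Structure N] [N ⊨ Lang.completeTheory F]
    (hF : FirstOrder.Language.IsFraisseLimit finiteClass.{u} F)
    (M : Lang.ElementarySubstructure N) : ℵ₀ ≤ #M := by
  have hM : M ⊨ Lang.completeTheory F := inferInstance
  have : Infinite M := (hasExt_of_model (N := M) hF).infinite (isZ_of_model hF)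
  exact Cardinal.aleph0_le_mk M

/-! ### The statements about a saturated model -/

section Model

variable {F : Type u} [Lang.Structure F] [Countable F]
  {N : Type u} [Lang.Structure N] [Nonempty N] [N ⊨ Lang.completeTheory F]

theorem exists_set_notMem (hF : FirstOrder.Language.IsFraisseLimit finiteClass.{u} F)
    {κ : Cardinal.{u}} (hs : IsSaturated Lang N κ) {M : Set N} (hM : #M < κ) :
    ∃ s₀ : N, IsSet s₀ ∧ ∀ t ∈ M, ¬ E t s₀ := by
  have hZ : (rels N).IsZ := isZ_of_model hF
  obtain ⟨z, -, hz, hz'⟩ := ((hasExt_of_isSaturated (hasExt_of_model hF) hs).dual hZ).exists_pt_mem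
    hZ.dual M hM
  refine ⟨z, hz, fun t ht hE => ?_⟩
  exact (hz' t ht (not_not.2 (hZ.sorts _ _ hE).1)).2.2 hE

theorem exists_point_mem (hF : FirstOrder.Language.IsFraisseLimit finiteClass.{u} F)
    {κ : Cardinal.{u}} (hs : IsSaturated Lang N κ) {M : Set N} (hM : #M < κ) :
    ∃ t₀ : N, IsPoint t₀ ∧ ∀ s ∈ M, IsSet s → E t₀ s := by
  obtain ⟨z, -, hz, hz'⟩ := (hasExt_of_isSaturated (hasExt_of_model hF) hs).exists_pt_mem
    (isZ_of_model hF) M hM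
  exact ⟨z, hz, hz'⟩

theorem isPoint_iff_of_tp_eq {M : Set N} {a b : Fin 1 → N} (h : tp Lang M a = tp Lang M b) :
    IsPoint (a 0) ↔ IsPoint (b 0) := by
  have := realize_iff_of_tp_eq h (relFormula pointSym ![0])
  rwa [realize_relFormula, realize_relFormula, relMap_point, relMap_point] at this

/-- Conjugates of a set are sets, and finitely many sets have a common point. -/
theorem not_quasiDivides_memFormula (hF : FirstOrder.Language.IsFraisseLimit finiteClass.{u} F)
    (M : Set N) {s₀ : N} (hs₀ : IsSet s₀) : ¬ QuasiDivides M memFormula ![s₀] := by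
  rintro ⟨n, b, hb, hn⟩
  obtain ⟨z, -, -, hz⟩ := (hasExt_of_model (N := N) hF).exists_pt_mem (isZ_of_model hF)
    (Set.range fun i => b i 0) (Cardinal.lt_aleph0_of_finite _)
  refine hn ⟨fun _ => z, fun i => (realize_memFormula _ _).2 (hz _ ⟨i, rfl⟩ fun h => ?_)⟩
  exact hs₀ ((isPoint_iff_of_tp_eq (hb i)).1 h)

theorem not_quasiDivides_notMemFormula (hF : FirstOrder.Language.IsFraisseLimit finiteClass.{u} F)
    (M : Set N) {t₀ : N} (ht₀ : IsPoint t₀) : ¬ QuasiDivides M notMemFormula ![t₀] := by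
  rintro ⟨n, b, hb, hn⟩
  have hZ : (rels N).IsZ := isZ_of_model hF
  obtain ⟨z, -, hz₀, hz⟩ := ((hasExt_of_model (N := N) hF).dual hZ).exists_pt_mem hZ.dual
    (Set.range fun i => b i 0) (Cardinal.lt_aleph0_of_finite _)
  refine hn ⟨fun _ => z, fun i => (realize_notMemFormula _ _).2 ⟨hz₀, ?_⟩⟩
  exact (hz _ ⟨i, rfl⟩ (not_not.2 ((isPoint_iff_of_tp_eq (hb i)).2 ht₀))).2.2

theorem forks_memFormula (hF : FirstOrder.Language.IsFraisseLimit finiteClass.{u} F)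
    {κ : Cardinal.{u}} (hs : IsSaturated Lang N κ) (hκ : ℵ₀ ≤ κ) {M : Set N} (hM : #M < κ)
    {s₀ : N} (hs₀ : IsSet s₀) (h : ∀ t ∈ M, ¬ E t s₀) : Forks M memFormula ![s₀] :=
  forks_of_realize_imp (r := rels N) (R := cSym) hF (isZ_of_model hF) (Or.inl rfl)
    (hasExt_of_isSaturated (hasExt_of_model hF) hs) hκ relMap_C hM hs₀ h
    (fun _ hx => (realize_memFormula _ _).1 hx)

theorem forks_notMemFormula (hF : FirstOrder.Language.IsFraisseLimit finiteClass.{u} F)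
    {κ : Cardinal.{u}} (hs : IsSaturated Lang N κ) (hκ : ℵ₀ ≤ κ) {M : Set N} (hM : #M < κ)
    {t₀ : N} (ht₀ : IsPoint t₀) (h : ∀ s ∈ M, IsSet s → E t₀ s) : Forks M notMemFormula ![t₀] := by
  have hZ : (rels N).IsZ := isZ_of_model hF
  -- In the dual structure `t₀` is a set without points in `M`, and `¬ E(t₀, y)` is membership in
  -- it.
  refine forks_of_realize_imp (r := (rels N).dual) (R := dSym) hF hZ.dual (Or.inr rfl)
    ((hasExt_of_isSaturated (hasExt_of_model hF) hs).dual hZ) hκ relMap_D hM (not_not.2 ht₀)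
    (fun s hs hE => hE.2.2 (h s hs hE.1)) (fun x hx => ?_)
  obtain ⟨h1, h2⟩ := (realize_notMemFormula _ _).1 hx
  exact ⟨h1, ht₀, h2⟩

/-- Let `s₀` avoid the points of `M` and let `c` realize `q` over `M s₀`. As `E(x, s₀)` forks, `¬
E(c, s₀)`. But `c`, like `t₀`, lies in all sets of `M`, so `¬ E(c, y)` forks over `M` and belongs to
`tp(s₀ / M c)`. -/
theorem not_exists_strictlyNonForking
    (hF : FirstOrder.Language.IsFraisseLimit finiteClass.{u} F)
    {κ : Cardinal.{u}} (hs : IsSaturated Lang N κ) (hκ : ℵ₀ ≤ κ) {M : Set N} (hM : #M < κ)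
    {t₀ : N} (ht₀ : IsPoint t₀) (h : ∀ s ∈ M, IsSet s → E t₀ s) :
    ¬ ∃ q : GlobalType Lang N 1, q.Extends (tp Lang M ![t₀]) ∧ q.StrictlyNonForking κ M := by
  rintro ⟨q, hq, hnf, hstrict⟩
  obtain ⟨s₀, hs₀, hM₀⟩ := exists_set_notMem hF hs hM
  have hC : #(insert s₀ M : Set N) < κ := (Cardinal.mk_insert_le).trans_lt
    (Cardinal.add_lt_of_lt hκ hM (one_lt_aleph0.trans_le hκ))
  obtain ⟨c, hc⟩ := hs.exists_realizesRestriction q hC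
  have hbase : ∀ (n : ℕ) (φ : Lang.Formula (Fin 1 ⊕ Fin n)) (a : Fin n → M),
      φ.Realize (Sum.elim ![t₀] fun i => (a i : N)) → φ.Realize (Sum.elim c fun i => (a i : N)) :=
    fun n φ a hφ => hc n φ _ (fun i => Set.mem_insert_of_mem _ (a i).2)
      (hq n φ a ((hasFormula_tp _ _ _).2 hφ))
  have hcpt : IsPoint (c 0) := by
    have := hbase 0 (relFormula pointSym ![Sum.inl 0]) (fun i => i.elim0)
    rw [realize_relFormula, realize_relFormula, relMap_point, relMap_point] at this
    exact this ht₀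
  have hcE : ∀ s ∈ M, IsSet s → E (c 0) s := fun s hsM hss =>
    (realize_memFormula _ _).1 (hbase 1 memFormula (fun _ => ⟨s, hsM⟩)
      ((realize_memFormula _ _).2 (h s hsM hss)))
  have hcs : ¬ E (c 0) s₀ := by
    have h1 : ¬ q.Has memFormula ![s₀] := fun h' =>
      hnf 1 memFormula ![s₀] h' (forks_memFormula hF hs hκ hM hs₀ hM₀)
    have h2 := hc 1 memFormula.not ![s₀] (fun i => by
      rw [Subsingleton.elim i 0]; exact Set.mem_insert _ _) (hasFormula_not h1)
    rw [FirstOrder.Language.Formula.realize_not, realize_memFormula] at h2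
    exact h2
  refine hstrict _ (Set.subset_insert _ _) hC c hc 1 1 notMemFormula ![s₀] ![c 0] (fun i => ?_)
    (fun i => ?_) ((realize_notMemFormula _ _).2 ⟨hs₀, hcs⟩)
    (forks_notMemFormula hF hs hκ hM hcpt hcE)
  · rw [Subsingleton.elim i 0]; exact Set.mem_insert _ _
  · rw [Subsingleton.elim i 0]; exact Or.inr ⟨0, rfl⟩

end Model

/-! ### Existence of saturated pairs, and TP2 -/

section Ambient

variable {F : Type u} [Lang.Structure F] [Countable F]

theorem nonempty_of_isFraisseLimit (hF : FirstOrder.Language.IsFraisseLimit finiteClass.{u} F) :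
    Nonempty F :=
  have := (hasExt_of_isFraisseLimit hF).infinite (isZ_of_isFraisseLimit hF)
  inferInstance

theorem exists_saturated (hF : FirstOrder.Language.IsFraisseLimit finiteClass.{u} F) :
    ∃ (N : Type u) (_ : Lang.Structure N) (_ : Nonempty N) (_ : N ⊨ Lang.completeTheory F)
      (κ : Cardinal.{u}) (M : Lang.ElementarySubstructure N), IsSaturated Lang N κ ∧ #M < κ := by
  have := countable_symbols
  have := nonempty_of_isFraisseLimit hF
  have hmod := ultrapower_models (L := Lang) (F := F)
  have : Infinite (Ultrapower F) := (hasExt_of_model hF).infinite (isZ_of_model hF)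
  obtain ⟨M, -, hM⟩ := FirstOrder.Language.exists_elementarySubstructure_card_eq Lang
    (∅ : Set (Ultrapower F)) (ℵ₀ : Cardinal.{u}) le_rfl (by simp)
    (by
      have h : Lang.card ≤ ℵ₀ := Cardinal.mk_le_aleph0 (α := Lang.Symbols)
      rw [Cardinal.lift_aleph0]
      exact Cardinal.lift_le_aleph0.2 h)
    (by simp)
  refine ⟨Ultrapower F, inferInstance, inferInstance, hmod, Order.succ ℵ₀, M,
    isSaturated_ultrapower, ?_⟩
  rw [Cardinal.lift_inj] at hM
  rw [hM]
  exact Order.lt_succ _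

/-- Row `j` consists of the arcs `[y (2i + 1), y (2i))` in the circle of `s j`, with the same points
`y` in every row. Within one circle the arcs are disjoint; positions in different circles are
independent, so every path is realized. -/
theorem hasTP2 (hF : FirstOrder.Language.IsFraisseLimit finiteClass.{u} F) :
    HasTP2.{0, 0, u} (Lang.completeTheory F) := by
  classical
  have := countable_symbols
  have := nonempty_of_isFraisseLimit hF
  have hmod := ultrapower_models (L := Lang) (F := F)
  have hZ : (rels (Ultrapower F)).IsZ := isZ_of_model hF
  have hext₀ : (rels (Ultrapower F)).HasExt ℵ₀ := hasExt_of_model hF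
  have hext : (rels (Ultrapower F)).HasExt (Order.succ ℵ₀) :=
    hasExt_of_isSaturated hext₀ isSaturated_ultrapower
  have hsmall : ∀ A : Set (Ultrapower F), A.Countable → #A < Order.succ ℵ₀ := fun A hA =>
    Order.lt_succ_iff.2 (Cardinal.mk_le_aleph0_iff.2 hA)
  obtain ⟨s, hs, hsne⟩ := exists_seq_of_forall_finset_exists (fun z : Ultrapower F => IsSet z)
    (fun x y => x ≠ y) (by
      intro S _
      obtain ⟨z, hz, hz', -⟩ := (hext₀.dual hZ).exists_pt_mem hZ.dual S
        (Cardinal.lt_aleph0_of_finite _)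
      exact ⟨z, hz', fun x hx h => hz (h ▸ hx)⟩)
  have hsinj : Function.Injective s := by
    intro i j hij
    by_contra h
    rcases lt_or_gt_of_ne h with h | h
    · exact hsne _ _ h hij
    · exact hsne _ _ h hij.symm
  obtain ⟨p, hpM, hp, hpE⟩ := hext.exists_pt_mem hZ (Set.range s) (hsmall _ (Set.countable_range s))
  have hps : ∀ j, (rels (Ultrapower F)).E p (s j) := fun j => hpE _ ⟨j, rfl⟩ (hs j)
  obtain ⟨y, hy, hy'⟩ := hext.exists_clones hZ (Order.le_succ _)
    (hsmall _ (Set.countable_range s)) hp hpM (fun _ => False)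
  have hyE : ∀ i j, (rels (Ultrapower F)).E (y i) (s j) := fun i j =>
    ((hy i).2.1 _ ⟨j, rfl⟩).2 (hps j)
  have hyC : ∀ i j, i < j → ∀ k, (rels (Ultrapower F)).C p (y j) (y i) (s k) := fun i j hij k =>
    ((hy' i j hij).2 _ ⟨k, rfl⟩ (hps k)).1 id
  have hcirc := fun j => hZ.C_circ (s j) (hs j)
  refine ⟨FirstOrder.Language.Theory.ModelType.of (Lang.completeTheory F) (Ultrapower F), 1, 3,
    arcFormula cSym 0 1, 1, fun j i => ![y (2 * i + 1), y (2 * i), s j], ?_, ?_⟩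
  · intro j I hI
    obtain ⟨n, m, hnm, rfl⟩ := Finset.card_eq_two.1 hI
    rintro ⟨x, hx⟩
    have h1 := (realize_arcFormula (r := rels (Ultrapower F)) relMap_C).1 (hx n (by simp))
    have h2 := (realize_arcFormula (r := rels (Ultrapower F)) relMap_C).1 (hx m (by simp))
    have key : ∀ n m, n < m → ∀ x, ((rels (Ultrapower F)).C (y (2 * n + 1)) x (y (2 * n)) (s j) ∨
        x = y (2 * n + 1)) → ¬ ((rels (Ultrapower F)).C (y (2 * m + 1)) x (y (2 * m)) (s j) ∨
        x = y (2 * m + 1)) := fun n m hnm x hx hx' =>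
      (hcirc j).disjoint_arcs (hyC _ _ (by omega) j) (hyC _ _ (by omega) j)
        (hyC _ _ (by omega) j) hx' hx
    rcases lt_or_gt_of_ne hnm with h | h
    · exact key _ _ h _ h1 h2
    · exact key _ _ h _ h2 h1
  · intro f
    -- The point after which the new element is inserted in each circle: the start of the chosen arc
    -- for `s j`, and `p` for all other sets containing `p`.
    let g : Ultrapower F → Ultrapower F := Function.extend s (fun j => y (2 * f j + 1)) fun _ => p
    have hg : ∀ j, g (s j) = y (2 * f j + 1) := fun j => hsinj.extend_apply _ _ _
    have hgE : ∀ t, (rels (Ultrapower F)).E p t → (rels (Ultrapower F)).E (g t) t := by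
      intro t ht
      by_cases h : ∃ j, s j = t
      · obtain ⟨j, rfl⟩ := h
        rw [hg]
        exact hyE _ _
      · rw [show g t = p from Function.extend_apply' _ _ _ h]
        exact ht
    obtain ⟨z, -, -, -, hzC, -⟩ := hext.exists_pt hZ (Set.range s ∪ Set.range y)
      (hsmall _ ((Set.countable_range s).union (Set.countable_range y)))
      (fun t => (rels (Ultrapower F)).E p t)
      (fun t => cutAfter (fun a => (rels (Ultrapower F)).E a t)
        (fun a b c => (rels (Ultrapower F)).C a b c t) (g t))
      (fun a b c => (rels (Ultrapower F)).D a b c p) (fun t ht => (hZ.sorts _ _ ht).2)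
      (fun t ht => (hZ.C_circ t (hZ.sorts _ _ ht).2).isCut_cutAfter (hgE t ht)) (hZ.D_circ p hp)
    refine ⟨fun _ => z, fun j => (realize_arcFormula (r := rels (Ultrapower F)) relMap_C).2
      (Or.inl ?_)⟩
    have hne : y (2 * f j) ≠ y (2 * f j + 1) := (hy' (2 * f j) (2 * f j + 1) (by omega)).1
    have h : (rels (Ultrapower F)).C z (y (2 * f j)) (y (2 * f j + 1)) (s j) :=
      (hzC (s j) (Or.inl ⟨_, rfl⟩) _ (Or.inr ⟨_, rfl⟩) _ (Or.inr ⟨_, rfl⟩)).2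
        ⟨hps j, Or.inl ⟨(hg j).symm, fun h => hne (h.trans (hg j)), hyE _ _, hyE _ _⟩⟩
    exact (hcirc j).cyc _ _ _ ((hcirc j).cyc _ _ _ h)

end Ambient

end Ziegler

theorem mainTheorem11 :
    -- the class is a Fraisse class and has a Fraisse limit
    FirstOrder.Language.IsFraisse Ziegler.finiteClass.{u} ∧
    (∃ (F : Type u) (_ : Ziegler.Lang.Structure F) (_ : Countable F),
      FirstOrder.Language.IsFraisseLimit Ziegler.finiteClass.{u} F) ∧
    ∀ (F : Type u) [Ziegler.Lang.Structure F] [Countable F],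
      FirstOrder.Language.IsFraisseLimit Ziegler.finiteClass.{u} F →
      -- the theory of the limit is countably categorical, eliminates quantifiers, has TP2
      Cardinal.Categorical.{0, 0, u} ℵ₀ (Ziegler.Lang.completeTheory F) ∧
      Ziegler.HasQE (Ziegler.Lang.completeTheory F) ∧
      Ziegler.HasTP2.{0, 0, u} (Ziegler.Lang.completeTheory F) ∧
      -- there is a model inside a sufficiently saturated ambient model
      (∃ (N : Type u) (_ : Ziegler.Lang.Structure N) (_ : Nonempty N)
          (_ : N ⊨ Ziegler.Lang.completeTheory F)
          (κ : Cardinal.{u}) (M : Ziegler.Lang.ElementarySubstructure N),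
        Ziegler.IsSaturated Ziegler.Lang N κ ∧ #M < κ) ∧
      -- for every small model `M` in a saturated ambient model `N`:
      ∀ (N : Type u) [Ziegler.Lang.Structure N] [Nonempty N]
        [N ⊨ Ziegler.Lang.completeTheory F]
        (κ : Cardinal.{u}) (M : Ziegler.Lang.ElementarySubstructure N),
        Ziegler.IsSaturated Ziegler.Lang N κ → #M < κ →
        (∃ s₀ : N, Ziegler.IsSet s₀ ∧ ∀ t ∈ M, ¬ Ziegler.E t s₀) ∧
        (∃ t₀ : N, Ziegler.IsPoint t₀ ∧ ∀ s ∈ M, Ziegler.IsSet s → Ziegler.E t₀ s) ∧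
        (∀ s₀ : N, Ziegler.IsSet s₀ → (∀ t ∈ M, ¬ Ziegler.E t s₀) →
          Ziegler.Forks (M : Set N) Ziegler.memFormula ![s₀] ∧
          ¬ Ziegler.Divides (M : Set N) Ziegler.memFormula ![s₀] ∧
          ¬ Ziegler.QuasiDivides (M : Set N) Ziegler.memFormula ![s₀]) ∧
        (∀ t₀ : N, Ziegler.IsPoint t₀ → (∀ s ∈ M, Ziegler.IsSet s → Ziegler.E t₀ s) →
          Ziegler.Forks (M : Set N) Ziegler.notMemFormula ![t₀] ∧
          ¬ Ziegler.Divides (M : Set N) Ziegler.notMemFormula ![t₀] ∧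
          ¬ Ziegler.QuasiDivides (M : Set N) Ziegler.notMemFormula ![t₀] ∧
          ¬ ∃ q : Ziegler.GlobalType Ziegler.Lang N 1,
            q.Extends (Ziegler.tp Ziegler.Lang (M : Set N) ![t₀]) ∧
            q.StrictlyNonForking κ (M : Set N)) := by
  refine ⟨?_, Ziegler.exists_isFraisseLimit, fun F _ _ hF => ⟨Ziegler.categorical hF,
    Ziegler.hasQE hF, Ziegler.hasTP2 hF, Ziegler.exists_saturated hF, ?_⟩⟩
  · obtain ⟨F, _, _, hF⟩ := Ziegler.exists_isFraisseLimit.{u}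
    exact hF.isFraisse
  · intro N _ _ _ κ M hs hM
    -- `κ` is infinite because `M`, a model of the theory, is.
    have hκ : ℵ₀ ≤ κ := (Ziegler.aleph0_le_of_elementarySubstructure hF M).trans hM.le
    have hM' : #(M : Set N) < κ := hM
    refine ⟨Ziegler.exists_set_notMem hF hs hM', Ziegler.exists_point_mem hF hs hM',
      fun s₀ hs₀ h => ⟨Ziegler.forks_memFormula hF hs hκ hM' hs₀ h,
        fun hd => Ziegler.not_quasiDivides_memFormula hF _ hs₀ hd.quasiDivides,
        Ziegler.not_quasiDivides_memFormula hF _ hs₀⟩,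
      fun t₀ ht₀ h => ⟨Ziegler.forks_notMemFormula hF hs hκ hM' ht₀ h,
        fun hd => Ziegler.not_quasiDivides_notMemFormula hF _ ht₀ hd.quasiDivides,
        Ziegler.not_quasiDivides_notMemFormula hF _ ht₀,
        Ziegler.not_exists_strictlyNonForking hF hs hκ hM' ht₀ h⟩⟩
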